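/- For $p\in[1,\infty)$ and a real $d\times d$ matrix $A$ let $\|A\|_{S_p}=\big(\mathrm{trace}\big((A^*A)^{p/2}\big)\big)^{1/p}$ denote its Schatten $p$-norm. There is a universal constant $c\in(0,\infty)$ with the following property. Let $p\in[2,\infty)$, $d,n\in\mathbb N$ and $k\in\{1,\ldots,n\}$. Then for all real $d\times d$ matrices $A_1,\ldots,A_n$, $$ \frac{(p/\sqrt{\log p})^{-p}}{2^n\binom{n}{k}}\sum_{\substack{S\subseteq\{1,\ldots,n\}\\|S|=k}}\ \sum_{\varepsilon\in\{-1,1\}^n}\Big\|\sum_{j\in S}\varepsilon_jA_j\Big\|_{S_p}^p \le c^p\left(\frac kn\sum_{j=1}^n\|A_j\|_{S_p}^p+\frac{(k/n)^{p/2}}{2^n}\sum_{\varepsilon\in\{-1,1\}^n}\Big\|\sum_{j=1}^n\varepsilon_jA_j\Big\|_{S_p}^p\right). $$ -/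

import Mathlib

/-- The Schatten `p`-norm of a real `d × d` matrix, `(trace ((A* A) ^ (p / 2))) ^ (1 / p)`.
The power of the positive semidefinite matrix `A* A` is taken by the functional calculus. -/
noncomputable def schattenNorm (p : ℝ) {d : ℕ} (A : Matrix (Fin d) (Fin d) ℝ) : ℝ :=
  (Matrix.trace (cfc (fun x : ℝ => x ^ (p / 2)) (A.conjTranspose * A))) ^ (1 / p)

/-- The signed sum `∑ j ∈ S, ε j • A j`; a sign is an element of `ℤˣ = {-1, 1}`. -/
noncomputable def signedSum {n d : ℕ} (A : Fin n → Matrix (Fin d) (Fin d) ℝ)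
    (S : Finset (Fin n)) (ε : Fin n → ℤˣ) : Matrix (Fin d) (Fin d) ℝ :=
  ∑ j ∈ S, (((ε j : ℤˣ) : ℤ) : ℝ) • A j

/-! Write q = p/2. Hermitian dilations H_j turn Schatten norms into traces of |x|^p. By the
noncommutative Khintchine inequality, the sign average of tr |∑_S ε_j H_j|^p is comparable to tr
(∑_S H_j²)^q: the upper bound loses 2(4(p-1))^q (`khintchine_upper`), the lower bound loses nothing
(`khintchine_lower`). What remains is a Rosenthal type bound for the positive matrices Z_j = H_j²
sampled without replacement (`rosenthal_sampling`). Its loss is of order (p / log p)^q, and the two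
losses multiply to c^p (p / √log p)^p.

For the Rosenthal bound, expand tr Y^q = ∑_{j ∈ S} tr Z_j Y^(q-1) with Y = ∑_S Z_j, and remove Z_j
from the power by tr A (A+B)^(q-1) ≤ K₂ tr A B^(q-1) + K₁ tr A^q. The K₁ terms give ∑ tr Z_j^q. In
the K₂ terms, double counting the pairs (S, j) leaves sets T with indices j outside T; Young's
inequality then yields tr (∑ Z_j)^q plus a term absorbed on the left. Getting K₂ of order p / log p
and K₁ of order (p / log p)^q up to c^q is the heart of the matter: a discrete Grönwall argument if
p ≥ 4, Jensen's inequality if p ≤ 4 (`exists_trace_mul_rpow_add_le`).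

Noncommutativity enters through one device: for Hermitian A, B with eigenvalues a_i, b_j, tr f(A)
g(B) = ∑ w_ij f(a_i) g(b_j) with weights w_ij ≥ 0 (`trace_cfc_mul_cfc`). Scalar inequalities between
sums of such products therefore lift to traces. -/

open Matrix

/-! ### Traces of functions of two Hermitian matrices -/

section TraceCalculus

variable {m : Type*} [Fintype m] [DecidableEq m] {A B : Matrix m m ℝ}

/-- The spectrum is finite, so arbitrary functions are admissible in the functional calculus,
negative powers included. -/
theorem continuousOn_spectrum_matrix (f : ℝ → ℝ) (A : Matrix m m ℝ) :
    ContinuousOn f (spectrum ℝ A) :=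
  (Matrix.finite_real_spectrum (A := A)).continuousOn f

theorem matrix_cfc_mul (f g : ℝ → ℝ) (A : Matrix m m ℝ) :
    cfc (fun x => f x * g x) A = cfc f A * cfc g A :=
  cfc_mul f g A (continuousOn_spectrum_matrix f A) (continuousOn_spectrum_matrix g A)

theorem cfc_eq_conj (hA : A.IsHermitian) (f : ℝ → ℝ) :
    cfc f A = (hA.eigenvectorUnitary : Matrix m m ℝ) * diagonal (fun i => f (hA.eigenvalues i)) *
      star (hA.eigenvectorUnitary : Matrix m m ℝ) := by
  rw [hA.cfc_eq f, IsHermitian.cfc, Unitary.conjStarAlgAut_apply]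
  rfl

theorem cfc_congr_eigenvalues (hA : A.IsHermitian) {f g : ℝ → ℝ}
    (h : ∀ i, f (hA.eigenvalues i) = g (hA.eigenvalues i)) : cfc f A = cfc g A := by
  rw [cfc_eq_conj hA, cfc_eq_conj hA]
  simp only [h]

theorem trace_cfc (hA : A.IsHermitian) (f : ℝ → ℝ) :
    trace (cfc f A) = ∑ i, f (hA.eigenvalues i) := by
  rw [cfc_eq_conj hA, trace_mul_cycle, Unitary.coe_star_mul_self, one_mul, trace_diagonal]

/-- The squared inner products of the eigenvectors of two Hermitian matrices. -/
noncomputable def eigenOverlap (hA : A.IsHermitian) (hB : B.IsHermitian) (i j : m) : ℝ :=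
  ((star (hA.eigenvectorUnitary : Matrix m m ℝ) * (hB.eigenvectorUnitary : Matrix m m ℝ)) i j) ^ 2

theorem eigenOverlap_nonneg (hA : A.IsHermitian) (hB : B.IsHermitian) (i j : m) :
    0 ≤ eigenOverlap hA hB i j := sq_nonneg _

theorem trace_diagonal_conj (U : Matrix m m ℝ) (a b : m → ℝ) :
    trace (diagonal a * U * diagonal b * star U) = ∑ i, ∑ j, U i j ^ 2 * (a i * b j) := by
  simp only [trace, diag_apply, mul_apply, star_apply, star_trivial,
    diagonal_apply, mul_ite, mul_zero, Finset.sum_ite_eq', Finset.mem_univ, if_true, ite_mul,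
    zero_mul, Finset.sum_ite_eq]
  refine Finset.sum_congr rfl fun i _ => Finset.sum_congr rfl fun j _ => ?_
  ring

/-- Diagonalize both matrices and use cyclicity of the trace. The nonnegative weights are what lets
scalar inequalities pass to traces. -/
theorem trace_cfc_mul_cfc (hA : A.IsHermitian) (hB : B.IsHermitian) (f g : ℝ → ℝ) :
    trace (cfc f A * cfc g B) =
      ∑ i, ∑ j, eigenOverlap hA hB i j * (f (hA.eigenvalues i) * g (hB.eigenvalues j)) := by
  have := trace_diagonal_conj
    (star (hA.eigenvectorUnitary : Matrix m m ℝ) * (hB.eigenvectorUnitary : Matrix m m ℝ))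
    (fun i => f (hA.eigenvalues i)) (fun j => g (hB.eigenvalues j))
  simp only [eigenOverlap]
  rw [← this, cfc_eq_conj hA, cfc_eq_conj hB, star_mul, star_star]
  simp only [mul_assoc]
  rw [trace_mul_comm]
  simp only [mul_assoc]

theorem sum_eigenOverlap (hA : A.IsHermitian) (hB : B.IsHermitian) (i : m) :
    ∑ j, eigenOverlap hA hB i j = 1 := by
  have h : (star (hA.eigenvectorUnitary : Matrix m m ℝ) *
      (hB.eigenvectorUnitary : Matrix m m ℝ)) * star (star (hA.eigenvectorUnitary : Matrix m m ℝ) *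
      (hB.eigenvectorUnitary : Matrix m m ℝ)) = 1 := by
    rw [star_mul, star_star, mul_assoc, ← mul_assoc (hB.eigenvectorUnitary : Matrix m m ℝ),
      (Unitary.mem_iff.1 hB.eigenvectorUnitary.2).2, one_mul, Unitary.coe_star_mul_self]
  have h2 := congrFun (congrFun h i) i
  rw [mul_apply, one_apply_eq] at h2
  rw [← h2]
  refine Finset.sum_congr rfl fun j _ => ?_
  rw [eigenOverlap, sq, star_apply (M := star _ * _), star_trivial (R := ℝ)]

theorem cfc_id_matrix (hA : A.IsHermitian) : cfc (fun x : ℝ => x) A = A :=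
  cfc_id' ℝ A (ha := hA)

theorem cfc_one_matrix (hA : A.IsHermitian) : cfc (fun _ : ℝ => (1 : ℝ)) A = 1 :=
  cfc_const_one ℝ A (ha := hA)

theorem isHermitian_cfc (f : ℝ → ℝ) (A : Matrix m m ℝ) : (cfc f A).IsHermitian :=
  IsSelfAdjoint.isHermitian (IsSelfAdjoint.cfc (f := f) (a := A))

theorem trace_cfc_left (hA : A.IsHermitian) (hB : B.IsHermitian) (f : ℝ → ℝ) :
    trace (cfc f A) = ∑ i, ∑ j, eigenOverlap hA hB i j * f (hA.eigenvalues i) := by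
  have := trace_cfc_mul_cfc hA hB f (fun _ => 1)
  rw [cfc_one_matrix hB, mul_one] at this
  simpa using this

theorem trace_cfc_right (hA : A.IsHermitian) (hB : B.IsHermitian) (g : ℝ → ℝ) :
    trace (cfc g B) = ∑ i, ∑ j, eigenOverlap hA hB i j * g (hB.eigenvalues j) := by
  have := trace_cfc_mul_cfc hA hB (fun _ => 1) g
  rw [cfc_one_matrix hA, one_mul] at this
  simpa using this

theorem trace_mul_cfc (hA : A.IsHermitian) (hB : B.IsHermitian) (g : ℝ → ℝ) :
    trace (A * cfc g B) =
      ∑ i, ∑ j, eigenOverlap hA hB i j * (hA.eigenvalues i * g (hB.eigenvalues j)) := by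
  have := trace_cfc_mul_cfc hA hB (fun x => x) g
  rwa [cfc_id_matrix hA] at this

theorem trace_sub_mul_cfc_sub (hA : A.IsHermitian) (hB : B.IsHermitian) (f : ℝ → ℝ) :
    trace ((A - B) * (cfc f A - cfc f B)) =
      ∑ i, ∑ j, eigenOverlap hA hB i j * ((hA.eigenvalues i - hB.eigenvalues j) *
        (f (hA.eigenvalues i) - f (hB.eigenvalues j))) := by
  have h1 : trace (A * cfc f A) = trace (cfc (fun x : ℝ => x * f x) A) := by
    rw [matrix_cfc_mul, cfc_id_matrix hA]
  have h2 : trace (B * cfc f B) = trace (cfc (fun x : ℝ => x * f x) B) := by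
    rw [matrix_cfc_mul, cfc_id_matrix hB]
  have h3 : trace (B * cfc f A) = trace (cfc f A * cfc (fun x : ℝ => x) B) := by
    rw [cfc_id_matrix hB, trace_mul_comm]
  rw [sub_mul, mul_sub, mul_sub, trace_sub, trace_sub, trace_sub, h1, h2, h3,
    trace_cfc_left hA hB, trace_mul_cfc hA hB, trace_cfc_mul_cfc hA hB, trace_cfc_right hA hB]
  simp only [← Finset.sum_sub_distrib]
  refine Finset.sum_congr rfl fun i _ => Finset.sum_congr rfl fun j _ => ?_
  ring

theorem trace_sub_sq_mul_cfc_left (hA : A.IsHermitian) (hB : B.IsHermitian) (h : ℝ → ℝ) :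
    trace ((A - B) * (A - B) * cfc h A) =
      ∑ i, ∑ j, eigenOverlap hA hB i j * ((hA.eigenvalues i - hB.eigenvalues j) ^ 2 *
        h (hA.eigenvalues i)) := by
  have e : trace ((A - B) * (A - B) * cfc h A) = trace (A * (A * cfc h A))
      - trace ((A * cfc h A) * B) - trace ((cfc h A * A) * B) + trace (cfc h A * (B * B)) := by
    have e1 : trace (B * A * cfc h A) = trace ((A * cfc h A) * B) := by
      rw [Matrix.mul_assoc, trace_mul_comm]
    have e2 : trace (A * B * cfc h A) = trace ((cfc h A * A) * B) := by
      rw [trace_mul_comm, mul_assoc]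
    have e3 : trace (B * B * cfc h A) = trace (cfc h A * (B * B)) := trace_mul_comm _ _
    rw [← e1, ← e2, ← e3, ← mul_assoc]
    simp only [sub_mul, mul_sub, trace_sub]
    ring
  have k1 : A * cfc h A = cfc (fun x : ℝ => x * h x) A := by rw [matrix_cfc_mul, cfc_id_matrix hA]
  have k2 : cfc h A * A = cfc (fun x : ℝ => h x * x) A := by rw [matrix_cfc_mul, cfc_id_matrix hA]
  have k3 : B * B = cfc (fun x : ℝ => x * x) B := by rw [matrix_cfc_mul, cfc_id_matrix hB]
  have k4 : A * (A * cfc h A) = cfc (fun x : ℝ => x * (x * h x)) A := by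
    rw [matrix_cfc_mul, cfc_id_matrix hA, k1]
  have k5 := trace_cfc_mul_cfc hA hB (fun x => x * h x) (fun x => x)
  have k6 := trace_cfc_mul_cfc hA hB (fun x => h x * x) (fun x => x)
  rw [cfc_id_matrix hB] at k5 k6
  rw [e, k4, k1, k2, k3, k5, k6, trace_cfc_mul_cfc hA hB, trace_cfc_left hA hB]
  simp only [← Finset.sum_sub_distrib, ← Finset.sum_add_distrib]
  refine Finset.sum_congr rfl fun i _ => Finset.sum_congr rfl fun j _ => ?_
  ring

theorem eigenOverlap_comm (hA : A.IsHermitian) (hB : B.IsHermitian) (i j : m) :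
    eigenOverlap hB hA j i = eigenOverlap hA hB i j := by
  have : star (hB.eigenvectorUnitary : Matrix m m ℝ) * (hA.eigenvectorUnitary : Matrix m m ℝ) =
      star (star (hA.eigenvectorUnitary : Matrix m m ℝ) *
        (hB.eigenvectorUnitary : Matrix m m ℝ)) := by rw [star_mul, star_star]
  rw [eigenOverlap, eigenOverlap, this, star_apply, star_trivial]

theorem trace_sub_sq_mul_cfc_right (hA : A.IsHermitian) (hB : B.IsHermitian) (h : ℝ → ℝ) :
    trace ((A - B) * (A - B) * cfc h B) =
      ∑ i, ∑ j, eigenOverlap hA hB i j * ((hA.eigenvalues i - hB.eigenvalues j) ^ 2 *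
        h (hB.eigenvalues j)) := by
  have e : (A - B) * (A - B) = (B - A) * (B - A) := by noncomm_ring
  rw [e, trace_sub_sq_mul_cfc_left hB hA, Finset.sum_comm]
  refine Finset.sum_congr rfl fun i _ => Finset.sum_congr rfl fun j _ => ?_
  rw [eigenOverlap_comm hA hB]
  ring

/-- The mean value trace inequality. -/
theorem trace_sub_mul_cfc_sub_le (hA : A.IsHermitian) (hB : B.IsHermitian) {f h : ℝ → ℝ} {C : ℝ}
    (H : ∀ i j, (hA.eigenvalues i - hB.eigenvalues j) *
        (f (hA.eigenvalues i) - f (hB.eigenvalues j)) ≤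
      C * ((hA.eigenvalues i - hB.eigenvalues j) ^ 2 *
        (h (hA.eigenvalues i) + h (hB.eigenvalues j)))) :
    trace ((A - B) * (cfc f A - cfc f B)) ≤
      C * (trace ((A - B) * (A - B) * cfc h A) + trace ((A - B) * (A - B) * cfc h B)) := by
  rw [trace_sub_mul_cfc_sub hA hB, trace_sub_sq_mul_cfc_left hA hB,
    trace_sub_sq_mul_cfc_right hA hB]
  simp only [← Finset.sum_add_distrib, Finset.mul_sum]
  refine Finset.sum_le_sum fun i _ => Finset.sum_le_sum fun j _ => ?_
  have := mul_le_mul_of_nonneg_left (H i j) (eigenOverlap_nonneg hA hB i j)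
  linarith

theorem trace_mul_nonneg_of_posSemidef (hA : A.PosSemidef) {g : ℝ → ℝ} (hB : B.PosSemidef)
    (hg : ∀ x, 0 ≤ x → 0 ≤ g x) : 0 ≤ trace (A * cfc g B) := by
  rw [trace_mul_cfc hA.1 hB.1]
  exact Finset.sum_nonneg fun i _ => Finset.sum_nonneg fun j _ =>
    mul_nonneg (eigenOverlap_nonneg _ _ _ _)
      (mul_nonneg (hA.eigenvalues_nonneg i) (hg _ (hB.eigenvalues_nonneg j)))

theorem trace_cfc_nonneg (hB : B.PosSemidef) {g : ℝ → ℝ}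
    (hg : ∀ x, 0 ≤ x → 0 ≤ g x) : 0 ≤ trace (cfc g B) := by
  rw [trace_cfc hB.1]
  exact Finset.sum_nonneg fun j _ => hg _ (hB.eigenvalues_nonneg j)

theorem mul_rpow_sub_one {x r : ℝ} (hx : 0 ≤ x) (hr : r ≠ 0) : x * x ^ (r - 1) = x ^ r := by
  rcases hx.eq_or_lt with rfl | hx
  · rw [zero_mul, Real.zero_rpow hr]
  · rw [Real.rpow_sub_one hx.ne', mul_div_cancel₀ _ hx.ne']

/-- Bernoulli's inequality at a/b - 1, multiplied by b^q. -/
theorem rpow_tangent_le {a b q : ℝ} (ha : 0 ≤ a) (hb : 0 ≤ b) (hq : 1 ≤ q) :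
    b ^ q + q * b ^ (q - 1) * (a - b) ≤ a ^ q := by
  rcases hb.eq_or_lt with rfl | hb
  · rcases hq.eq_or_lt with rfl | hq'
    · simp
    · rw [Real.zero_rpow (by linarith), Real.zero_rpow (by linarith)]
      simpa using Real.rpow_nonneg ha q
  · have hs : -1 ≤ a / b - 1 := by have := div_nonneg ha hb.le; linarith
    have := one_add_mul_self_le_rpow_one_add hs hq
    rw [add_sub_cancel, Real.div_rpow ha hb.le, le_div_iff₀ (Real.rpow_pos_of_pos hb q)] at this
    have e := mul_rpow_sub_one hb.le (by linarith : q ≠ 0)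
    calc _ = (1 + q * (a / b - 1)) * b ^ q := by rw [← e]; field_simp
      _ ≤ _ := this

/-- Klein's inequality for the power functions. -/
theorem trace_rpow_ge_tangent (hA : A.PosSemidef) (hB : B.PosSemidef) {q : ℝ} (hq : 1 ≤ q) :
    trace (cfc (fun x : ℝ => x ^ q) B) + q * trace ((A - B) * cfc (fun x : ℝ => x ^ (q - 1)) B) ≤
      trace (cfc (fun x : ℝ => x ^ q) A) := by
  have h2 : trace (B * cfc (fun x : ℝ => x ^ (q - 1)) B) =
      trace (cfc (fun x : ℝ => x * x ^ (q - 1)) B) := by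
    rw [matrix_cfc_mul, cfc_id_matrix hB.1]
  rw [sub_mul, trace_sub, h2, trace_mul_cfc hA.1 hB.1, trace_cfc_right hA.1 hB.1,
    trace_cfc_right hA.1 hB.1, trace_cfc_left hA.1 hB.1]
  simp only [← Finset.sum_sub_distrib, ← Finset.sum_add_distrib, Finset.mul_sum]
  refine Finset.sum_le_sum fun i _ => Finset.sum_le_sum fun j _ => ?_
  have ha := hA.eigenvalues_nonneg i
  have hb := hB.eigenvalues_nonneg j
  generalize hA.1.eigenvalues i = a at *
  generalize hB.1.eigenvalues j = b at *
  have key := rpow_tangent_le ha hb hq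
  have := mul_le_mul_of_nonneg_left key (eigenOverlap_nonneg hA.1 hB.1 i j)
  linarith

/-- In Klein's inequality at `B` the linear term is the trace of a product of two positive matrices.
No operator monotonicity is needed. -/
theorem trace_rpow_mono (hA : A.PosSemidef) (hB : B.PosSemidef) {q : ℝ} (hq : 1 ≤ q) :
    trace (cfc (fun x : ℝ => x ^ q) B) ≤ trace (cfc (fun x : ℝ => x ^ q) (B + A)) := by
  have h := trace_rpow_ge_tangent (hB.add hA) hB hq
  rw [add_sub_cancel_left] at h
  have := trace_mul_nonneg_of_posSemidef hA (g := fun x => x ^ (q - 1)) hB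
    (fun x hx => Real.rpow_nonneg hx _)
  nlinarith

end TraceCalculus

/-! ### Scalar inequalities to be lifted to traces -/

section ScalarInequalities

/-- By convexity the slope is at most the derivative at the larger point; the sum on the right makes
the bound symmetric. -/
theorem sub_mul_rpow_sub_le {x y r : ℝ} (hx : 0 ≤ x) (hy : 0 ≤ y) (hr : 1 ≤ r) :
    (x - y) * (x ^ r - y ^ r) ≤ r * ((x - y) ^ 2 * (x ^ (r - 1) + y ^ (r - 1))) := by
  wlog hxy : y ≤ x generalizing x y
  · have := this hy hx (le_of_not_ge hxy)
    linarith
  have h1 := rpow_tangent_le hy hx hr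
  have h2 : x ^ r - y ^ r ≤ r * x ^ (r - 1) * (x - y) := by linarith
  have h3 := mul_le_mul_of_nonneg_left h2 (sub_nonneg.2 hxy)
  have h4 : 0 ≤ r * ((x - y) ^ 2 * y ^ (r - 1)) := by positivity
  nlinarith

theorem sub_mul_signed_rpow_sub_le {p : ℝ} (hp : 2 ≤ p) (x y : ℝ) :
    (x - y) * (x * |x| ^ (p - 2) - y * |y| ^ (p - 2)) ≤
      (p - 1) * ((x - y) ^ 2 * (|x| ^ (p - 2) + |y| ^ (p - 2))) := by
  have pos : ∀ x y : ℝ, 0 ≤ x → 0 ≤ y → (x - y) * (x * x ^ (p - 2) - y * y ^ (p - 2)) ≤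
      (p - 1) * ((x - y) ^ 2 * (x ^ (p - 2) + y ^ (p - 2))) := by
    intro x y hx hy
    have h := sub_mul_rpow_sub_le hx hy (by linarith : 1 ≤ p - 1)
    rw [← mul_rpow_sub_one hx (by linarith : p - 1 ≠ 0),
      ← mul_rpow_sub_one hy (by linarith : p - 1 ≠ 0)] at h
    rwa [show p - 1 - 1 = p - 2 by ring] at h
  have opp : ∀ x y : ℝ, 0 ≤ x → 0 ≤ y → (x + y) * (x * x ^ (p - 2) + y * y ^ (p - 2)) ≤
      (p - 1) * ((x + y) ^ 2 * (x ^ (p - 2) + y ^ (p - 2))) := by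
    intro x y hx hy
    have h1 := Real.rpow_nonneg hx (p - 2)
    have h2 := Real.rpow_nonneg hy (p - 2)
    have h3 : x * x ^ (p - 2) + y * y ^ (p - 2) ≤ (x + y) * (x ^ (p - 2) + y ^ (p - 2)) := by
      nlinarith [mul_nonneg hx h2, mul_nonneg hy h1]
    have h4 : 0 ≤ (x + y) ^ 2 * (x ^ (p - 2) + y ^ (p - 2)) := by positivity
    nlinarith [mul_le_mul_of_nonneg_left h3 (add_nonneg hx hy)]
  rcases le_total 0 x with hx | hx <;> rcases le_total 0 y with hy | hy
  · rw [abs_of_nonneg hx, abs_of_nonneg hy]; exact pos x y hx hy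
  · rw [abs_of_nonneg hx, abs_of_nonpos hy]
    have := opp x (-y) hx (by linarith)
    simpa only [← sub_eq_add_neg, sub_neg_eq_add, neg_mul] using this
  · rw [abs_of_nonpos hx, abs_of_nonneg hy]
    have := opp (-x) y (by linarith) hy
    have e : (x - y) ^ 2 = (-x + y) ^ 2 := by ring
    rw [e]
    linarith
  · rw [abs_of_nonpos hx, abs_of_nonpos hy]
    have := pos (-x) (-y) (by linarith) (by linarith)
    have e : (x - y) ^ 2 = (-x - -y) ^ 2 := by ring
    rw [e]
    linarith

/-- Either a ≤ εy and the first term dominates, or y ≤ a/ε and the second does. -/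
theorem sq_mul_rpow_le {a y r ε : ℝ} (ha : 0 ≤ a) (hy : 0 ≤ y) (hr : 1 ≤ r) (hε : 0 < ε) :
    a ^ 2 * y ^ (r - 1) ≤ ε * (a * y ^ r) + ε * (ε ^ (-r) * a ^ (r + 1)) := by
  have hy1 := Real.rpow_nonneg hy (r - 1)
  have e := mul_rpow_sub_one hy (by linarith : r ≠ 0)
  rcases le_total a (ε * y) with h | h
  · have h1 : a ^ 2 * y ^ (r - 1) ≤ ε * (a * y ^ r) := by
      rw [← e]
      nlinarith [mul_le_mul_of_nonneg_right h (mul_nonneg ha hy1)]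
    have h2 : 0 ≤ ε * (ε ^ (-r) * a ^ (r + 1)) := by positivity
    linarith
  · have h1 : y ≤ a / ε := by rwa [le_div_iff₀ hε, mul_comm]
    have h2 : y ^ (r - 1) ≤ a ^ (r - 1) / ε ^ (r - 1) := by
      rw [← Real.div_rpow ha hε.le]
      exact Real.rpow_le_rpow hy h1 (by linarith)
    have h3 : a ^ (r + 1) = a ^ 2 * a ^ (r - 1) := by
      have k1 := mul_rpow_sub_one ha (by linarith : r + 1 ≠ 0)
      have k2 := mul_rpow_sub_one ha (by linarith : r ≠ 0)
      rw [add_sub_cancel_right] at k1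
      rw [← k1, ← k2]; ring
    have h4 : ε * ε ^ (-r) = (ε ^ (r - 1))⁻¹ := by
      rw [Real.rpow_neg hε.le, ← mul_rpow_sub_one hε.le (by linarith : r ≠ 0), mul_inv,
        mul_inv_cancel_left₀ hε.ne']
    have h5 : 0 ≤ ε * (a * y ^ r) := by positivity
    calc a ^ 2 * y ^ (r - 1) ≤ a ^ 2 * (a ^ (r - 1) / ε ^ (r - 1)) := by gcongr
      _ = ε * (ε ^ (-r) * a ^ (r + 1)) := by rw [← mul_assoc, h4, h3]; ring
      _ ≤ _ := by linarith

end ScalarInequalities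

/-! ### Separating A from (A + B)^r when r ≥ 1 -/

section TraceMinkowski

variable {m : Type*} [Fintype m] [DecidableEq m] {A B : Matrix m m ℝ}

theorem trace_sq_mul_cfc (hA : A.IsHermitian) (hB : B.IsHermitian) (h : ℝ → ℝ) :
    trace (A * A * cfc h B) = ∑ i, ∑ j, eigenOverlap hA hB i j *
      (hA.eigenvalues i ^ 2 * h (hB.eigenvalues j)) := by
  have k : A * A = cfc (fun x : ℝ => x * x) A := by rw [matrix_cfc_mul, cfc_id_matrix hA]
  rw [k, trace_cfc_mul_cfc hA hB]
  simp only [sq]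

theorem trace_sq_mul_rpow_le (hA : A.PosSemidef) (hB : B.PosSemidef) {r ε : ℝ} (hr : 1 ≤ r)
    (hε : 0 < ε) :
    trace (A * A * cfc (fun x : ℝ => x ^ (r - 1)) B) ≤
      ε * trace (A * cfc (fun x : ℝ => x ^ r) B) +
        ε * (ε ^ (-r) * trace (cfc (fun x : ℝ => x ^ (r + 1)) A)) := by
  rw [trace_sq_mul_cfc hA.1 hB.1, trace_mul_cfc hA.1 hB.1, trace_cfc_left hA.1 hB.1]
  simp only [Finset.mul_sum, ← Finset.sum_add_distrib]
  refine Finset.sum_le_sum fun i _ => Finset.sum_le_sum fun j _ => ?_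
  have := mul_le_mul_of_nonneg_left (sq_mul_rpow_le (hA.eigenvalues_nonneg i)
    (hB.eigenvalues_nonneg j) hr hε) (eigenOverlap_nonneg hA.1 hB.1 i j)
  linarith

/-- One Grönwall step from `B` to `B + t • A`: the mean value inequality bounds the increment by
traces of A² times an (r-1)-th power, which are split with parameter `ε`. -/
theorem trace_mul_rpow_add_smul_le (hA : A.PosSemidef) (hB : B.PosSemidef) {r ε t : ℝ}
    (hr : 1 ≤ r) (hε : 0 < ε) (ht : 0 < t) :
    (1 - r * ε * t) * trace (A * cfc (fun x : ℝ => x ^ r) (B + t • A)) ≤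
      (1 + r * ε * t) * trace (A * cfc (fun x : ℝ => x ^ r) B) +
        2 * (r * ε * t) * (ε ^ (-r) * trace (cfc (fun x : ℝ => x ^ (r + 1)) A)) := by
  have hY : (B + t • A).PosSemidef := hB.add (hA.smul ht.le)
  have h := trace_sub_mul_cfc_sub_le hY.1 hB.1 (f := fun x => x ^ r) (h := fun x => x ^ (r - 1))
    (C := r) (fun i j => sub_mul_rpow_sub_le (hY.eigenvalues_nonneg i) (hB.eigenvalues_nonneg j) hr)
  have h1 := trace_sq_mul_rpow_le hA hY hr hε
  have h2 := trace_sq_mul_rpow_le hA hB hr hε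
  simp only [add_sub_cancel_left, smul_mul_assoc, mul_smul_comm, trace_smul, smul_eq_mul, mul_sub,
    trace_sub] at h
  have h3 := mul_le_mul_of_nonneg_left (add_le_add h1 h2) (by positivity : 0 ≤ r * t)
  refine le_of_mul_le_mul_left ?_ ht
  nlinarith

theorem trace_mul_rpow_add_le (hA : A.PosSemidef) (hB : B.PosSemidef) {r ε : ℝ}
    (hr : 1 ≤ r) (hε : 0 < ε) :
    trace (A * cfc (fun x : ℝ => x ^ r) (A + B)) ≤
      Real.exp (3 * (r * ε)) * (trace (A * cfc (fun x : ℝ => x ^ r) B) +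
        ε ^ (-r) * trace (cfc (fun x : ℝ => x ^ (r + 1)) A)) := by
  obtain ⟨N, hN⟩ := exists_nat_ge (3 * (r * ε))
  have hN0 : (0 : ℝ) < N := lt_of_lt_of_le (by positivity) hN
  set c := ε ^ (-r) * trace (cfc (fun x : ℝ => x ^ (r + 1)) A) with hc
  have hc0 : 0 ≤ c := mul_nonneg (Real.rpow_nonneg hε.le _)
    (trace_cfc_nonneg hA fun x hx => Real.rpow_nonneg hx _)
  set x := r * ε * (1 / N : ℝ) with hx
  have hx0 : 0 < x := by positivity
  have hx2 : x ≤ 1 / 3 := by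
    rw [hx, mul_one_div, div_le_iff₀ hN0]; linarith
  -- (1 + 3x)(1 - x) ≥ 1 + x exactly because 0 ≤ x ≤ 1/3; this is why at least 3rε steps are taken.
  have hρ : (1 + x) ≤ Real.exp (3 * x) * (1 - x) := by
    have e1 : 3 * x + 1 ≤ Real.exp (3 * x) := Real.add_one_le_exp _
    nlinarith
  -- Adding `c` makes the recursion homogeneous: each step multiplies by at most exp(3x), and N
  -- steps give exp(3rε).
  have key : ∀ i : ℕ, trace (A * cfc (fun x : ℝ => x ^ r) (B + ((i : ℝ) * (1 / N : ℝ)) • A)) + c ≤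
      Real.exp (3 * x) ^ i * (trace (A * cfc (fun x : ℝ => x ^ r) B) + c) := by
    intro i
    induction i with
    | zero => simp
    | succ i ih =>
      have hY : (B + ((i : ℝ) * (1 / N : ℝ)) • A).PosSemidef := hB.add (hA.smul (by positivity))
      have h := trace_mul_rpow_add_smul_le hA hY hr hε (t := 1 / N) (by positivity)
      rw [add_assoc, ← add_smul, ← add_one_mul, ← hx, ← hc] at h
      push_cast
      have hg := trace_mul_nonneg_of_posSemidef hA (g := fun x => x ^ r) hY
        (fun x hx => Real.rpow_nonneg hx _)
      generalize trace (A * cfc (fun x : ℝ => x ^ r) (B + (((i : ℝ) + 1) * (1 / N : ℝ)) • A)) = u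
        at *
      generalize trace (A * cfc (fun x : ℝ => x ^ r) (B + ((i : ℝ) * (1 / N : ℝ)) • A)) = v at *
      have h5 : (1 - x) * (u + c) ≤ (1 + x) * (v + c) := by linarith
      have h6 : (1 - x) * (u + c) ≤ (1 - x) * (Real.exp (3 * x) * (v + c)) := by
        nlinarith
      have h7 := le_of_mul_le_mul_left h6 (by linarith)
      calc u + c ≤ Real.exp (3 * x) * (v + c) := h7
        _ ≤ Real.exp (3 * x) * (Real.exp (3 * x) ^ i * _) :=
          mul_le_mul_of_nonneg_left ih (Real.exp_pos _).le
        _ = _ := by ring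
  have h := key N
  rw [mul_one_div_cancel hN0.ne', one_smul, ← Real.exp_nat_mul, add_comm B A] at h
  have e : (N : ℝ) * (3 * x) = 3 * (r * ε) := by rw [hx]; field_simp
  rw [e] at h
  linarith

end TraceMinkowski

/-! ### Separating A from (A + B)^r when 0 ≤ r ≤ 1 -/

section TraceSubadditivity

variable {m : Type*} [Fintype m] [DecidableEq m] {A B : Matrix m m ℝ}

/-- Since t^(r-1) is decreasing, a weight at `y` alone suffices; `y` will be an eigenvalue of A + B.
-/
theorem sub_mul_rpow_sub_le_of_le_one {y b r : ℝ} (hy : 0 < y) (hb : 0 ≤ b) (hr0 : 0 < r)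
    (hr : r ≤ 1) : (y - b) * (y ^ r - b ^ r) ≤ (y - b) ^ 2 * y ^ (r - 1) := by
  have hY : y ^ r = y * y ^ (r - 1) := (mul_rpow_sub_one hy.le hr0.ne').symm
  rcases hb.eq_or_lt with rfl | hb
  · rw [Real.zero_rpow hr0.ne', hY]; apply le_of_eq; ring
  have hB : b ^ r = b * b ^ (r - 1) := (mul_rpow_sub_one hb.le hr0.ne').symm
  rw [hY, hB]
  rcases le_total b y with h | h
  · have h1 : y ^ (r - 1) ≤ b ^ (r - 1) := Real.rpow_le_rpow_of_nonpos hb h (by linarith)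
    nlinarith [mul_le_mul_of_nonneg_left h1 (mul_nonneg (sub_nonneg.2 h) hb.le)]
  · have h1 : b ^ (r - 1) ≤ y ^ (r - 1) := Real.rpow_le_rpow_of_nonpos hy h (by linarith)
    nlinarith [mul_le_mul_of_nonneg_left h1 (mul_nonneg (sub_nonneg.2 h) hb.le)]

/-- The quadratic form of `B` in an eigenvector of `A`, as a sum over eigenvalues of `B`. -/
theorem conj_cfc_apply_self (hA : A.IsHermitian) (hB : B.IsHermitian) (g : ℝ → ℝ) (i : m) :
    (star (hA.eigenvectorUnitary : Matrix m m ℝ) * cfc g B *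
      (hA.eigenvectorUnitary : Matrix m m ℝ)) i i =
      ∑ j, eigenOverlap hA hB i j * g (hB.eigenvalues j) := by
  have e : star (hA.eigenvectorUnitary : Matrix m m ℝ) * cfc g B *
      (hA.eigenvectorUnitary : Matrix m m ℝ) =
      (star (hA.eigenvectorUnitary : Matrix m m ℝ) * (hB.eigenvectorUnitary : Matrix m m ℝ)) *
      diagonal (fun j => g (hB.eigenvalues j)) *
      star (star (hA.eigenvectorUnitary : Matrix m m ℝ) *
        (hB.eigenvectorUnitary : Matrix m m ℝ)) := by
    rw [cfc_eq_conj hB, star_mul, star_star]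
    simp only [mul_assoc]
  rw [e, mul_apply]
  refine Finset.sum_congr rfl fun j _ => ?_
  rw [mul_diagonal, star_apply (M := star _ * _), star_trivial (R := ℝ), eigenOverlap]
  ring

theorem conj_apply_self (hA : A.IsHermitian) (hB : B.IsHermitian) (i : m) :
    (star (hA.eigenvectorUnitary : Matrix m m ℝ) * B *
      (hA.eigenvectorUnitary : Matrix m m ℝ)) i i =
      ∑ j, eigenOverlap hA hB i j * hB.eigenvalues j := by
  rw [← conj_cfc_apply_self hA hB (fun x => x), cfc_id_matrix hB]

theorem conj_apply_self_nonneg (hA : A.IsHermitian) (hB : B.PosSemidef) (i : m) :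
    0 ≤ (star (hA.eigenvectorUnitary : Matrix m m ℝ) * B *
      (hA.eigenvectorUnitary : Matrix m m ℝ)) i i := by
  rw [conj_apply_self hA hB.1]
  exact Finset.sum_nonneg fun j _ =>
    mul_nonneg (eigenOverlap_nonneg _ _ _ _) (hB.eigenvalues_nonneg j)

/-- On a null vector of A + B both quadratic forms vanish, being nonnegative with sum zero. -/
theorem eigenOverlap_add_eq_zero (hA : A.PosSemidef) (hB : B.PosSemidef) (i j : m)
    (hi : (hA.add hB).1.eigenvalues i = 0) :
    eigenOverlap (hA.add hB).1 hB.1 i j * hB.1.eigenvalues j = 0 := by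
  have hY := (hA.add hB).1
  have h1 : (star (hY.eigenvectorUnitary : Matrix m m ℝ) * (A + B) *
      (hY.eigenvectorUnitary : Matrix m m ℝ)) i i = 0 := by
    have : star (hY.eigenvectorUnitary : Matrix m m ℝ) * (A + B) *
      (hY.eigenvectorUnitary : Matrix m m ℝ) = diagonal hY.eigenvalues := by
      have hs := cfc_eq_conj hY (fun x => x)
      rw [cfc_id_matrix hY] at hs
      refine (congrArg (fun M => star (hY.eigenvectorUnitary : Matrix m m ℝ) * M *
        (hY.eigenvectorUnitary : Matrix m m ℝ)) hs).trans ?_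
      simp only [mul_assoc]
      rw [Unitary.coe_star_mul_self, mul_one, ← mul_assoc, Unitary.coe_star_mul_self, one_mul]
    rw [this, diagonal_apply_eq, hi]
  rw [mul_add, add_mul, Matrix.add_apply] at h1
  have h2 := conj_apply_self_nonneg hY hA i
  have h3 := conj_apply_self_nonneg hY hB i
  have h4 : ∑ j, eigenOverlap hY hB.1 i j * hB.1.eigenvalues j = 0 := by
    rw [← conj_apply_self hY hB.1]; linarith
  exact (Finset.sum_eq_zero_iff_of_nonneg fun j _ =>
    mul_nonneg (eigenOverlap_nonneg _ _ _ _) (hB.eigenvalues_nonneg j)).1 h4 j (Finset.mem_univ j)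

/-- The compression of the (pseudo)inverse of `A + B` to an eigenvector of `A`. -/
theorem eigenvalue_mul_sum_inv_le (hA : A.PosSemidef) (hB : B.PosSemidef) (i : m) :
    hA.1.eigenvalues i * ∑ j, eigenOverlap hA.1 (hA.add hB).1 i j *
      ((hA.add hB).1.eigenvalues j)⁻¹ ≤ 1 := by
  have hY := (hA.add hB).1
  set U := (hA.1.eigenvectorUnitary : Matrix m m ℝ) with hU
  have hUU : U * star U = 1 := (Unitary.mem_iff.1 hA.1.eigenvectorUnitary.2).2
  set P := cfc (fun x : ℝ => x⁻¹) (A + B) with hP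
  have hPs : Pᴴ = P := isHermitian_cfc _ _
  have hPYP : P * (A + B) * P = P := by
    conv_lhs => rw [← cfc_id_matrix hY, cfc_id_matrix hY]
    rw [hP]
    conv_lhs => enter [1, 2]; rw [← cfc_id_matrix hY]
    rw [← matrix_cfc_mul, ← matrix_cfc_mul]
    refine cfc_congr_eigenvalues hY fun j => ?_
    by_cases h0 : hY.eigenvalues j = 0
    · simp [h0]
    · field_simp
  rw [← conj_cfc_apply_self hA.1 hY (fun x => x⁻¹), ← hU, ← hP]
  -- From P = PAP + PBP, dropping the positive second term, Q_ii ≥ ∑ Q_il² a_l ≥ Q_ii² a_i. Hence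
  -- a_i Q_ii ≤ 1.
  set Q := star U * P * U with hQ
  have hQQ : Q i i = (star U * (P * A * P) * U) i i + (star U * (P * B * P) * U) i i := by
    rw [← Matrix.add_apply, ← add_mul, ← mul_add, ← add_mul, ← mul_add, hPYP]
  have hpos : 0 ≤ (star U * (P * B * P) * U) i i := by
    have : (star U * (P * B * P) * U).PosSemidef := by
      have h := (hB.conjTranspose_mul_mul_same P).conjTranspose_mul_mul_same U
      rwa [hPs] at h
    exact this.diag_nonneg
  have hAA : (star U * (P * A * P) * U) i i = ∑ l, Q i l ^ 2 * hA.1.eigenvalues l := by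
    have e : star U * (P * A * P) * U = Q * diagonal hA.1.eigenvalues * star Q := by
      have hs : star Q = Q := by
        rw [hQ, star_mul, star_mul, star_star, star_eq_conjTranspose P, hPs, mul_assoc]
      rw [hs, hQ]
      conv_lhs => rw [← cfc_id_matrix hA.1, cfc_eq_conj hA.1]
      simp only [mul_assoc, hU]
    rw [e, mul_apply]
    refine Finset.sum_congr rfl fun l _ => ?_
    rw [mul_diagonal, star_apply, star_trivial]
    ring
  have hge : Q i i ^ 2 * hA.1.eigenvalues i ≤ ∑ l, Q i l ^ 2 * hA.1.eigenvalues l :=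
    Finset.single_le_sum (f := fun l => Q i l ^ 2 * hA.1.eigenvalues l)
      (fun l _ => mul_nonneg (sq_nonneg _) (hA.eigenvalues_nonneg l)) (Finset.mem_univ i)
  have h : Q i i ^ 2 * hA.1.eigenvalues i ≤ Q i i := by linarith
  by_contra! hc
  have hQ0 : 0 < Q i i := by
    by_contra! h0
    have := mul_nonpos_of_nonneg_of_nonpos (hA.eigenvalues_nonneg i) h0
    linarith
  nlinarith

/-- Jensen for the concave power 1 - r, applied to the inverse eigenvalues of A + B averaged over an
eigenvector of `A`; that average is at most 1/a. Zero eigenvalues are harmless, as 0⁻¹ = 0 and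
0^(r-1) = 0 for r < 1. -/
theorem trace_sq_mul_rpow_add_le (hA : A.PosSemidef) (hB : B.PosSemidef) {r : ℝ}
    (hr0 : 0 < r) (hr : r < 1) :
    trace (A * A * cfc (fun x : ℝ => x ^ (r - 1)) (A + B)) ≤
      trace (cfc (fun x : ℝ => x ^ (r + 1)) A) := by
  have hY := hA.add hB
  rw [trace_sq_mul_cfc hA.1 hY.1, trace_cfc hA.1]
  refine Finset.sum_le_sum fun i _ => ?_
  have ha := hA.eigenvalues_nonneg i
  have hinv := eigenvalue_mul_sum_inv_le hA hB i
  have hw : ∑ j, eigenOverlap hA.1 hY.1 i j = 1 := sum_eigenOverlap _ _ _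
  have e : ∀ j, hY.1.eigenvalues j ^ (r - 1) = (hY.1.eigenvalues j)⁻¹ ^ (1 - r) := fun j => by
    rw [Real.inv_rpow (hY.eigenvalues_nonneg j), ← Real.rpow_neg (hY.eigenvalues_nonneg j), neg_sub]
  have J := (Real.concaveOn_rpow (p := 1 - r) (by linarith) (by linarith)).le_map_sum
    (t := Finset.univ) (w := fun j => eigenOverlap hA.1 hY.1 i j)
    (p := fun j => (hY.1.eigenvalues j)⁻¹) (fun j _ => eigenOverlap_nonneg _ _ _ _) hw
    (fun j _ => inv_nonneg.2 (hY.eigenvalues_nonneg j))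
  simp only [smul_eq_mul] at J
  have e2 : ∑ j, eigenOverlap hA.1 hY.1 i j * (hA.1.eigenvalues i ^ 2 *
      hY.1.eigenvalues j ^ (r - 1)) = hA.1.eigenvalues i ^ 2 *
      ∑ j, eigenOverlap hA.1 hY.1 i j * (hY.1.eigenvalues j)⁻¹ ^ (1 - r) := by
    rw [Finset.mul_sum]
    refine Finset.sum_congr rfl fun j _ => ?_
    rw [e]; ring
  rw [e2]
  set s := ∑ j, eigenOverlap hA.1 hY.1 i j * (hY.1.eigenvalues j)⁻¹ with hs
  have hs0 : 0 ≤ s := Finset.sum_nonneg fun j _ =>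
    mul_nonneg (eigenOverlap_nonneg _ _ _ _) (inv_nonneg.2 (hY.eigenvalues_nonneg j))
  generalize hA.1.eigenvalues i = a at *
  rcases ha.eq_or_lt with rfl | ha
  · simp [Real.zero_rpow (by linarith : r + 1 ≠ 0)]
  · have h1 : s ≤ a⁻¹ := by rwa [← one_div, le_div_iff₀ ha, mul_comm]
    have h2 : s ^ (1 - r) ≤ a⁻¹ ^ (1 - r) := Real.rpow_le_rpow hs0 h1 (by linarith)
    calc _ ≤ a ^ 2 * a⁻¹ ^ (1 - r) := by
          refine mul_le_mul_of_nonneg_left (J.trans h2) (sq_nonneg a)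
      _ = a ^ (r + 1) := by
        rw [Real.inv_rpow ha.le, ← Real.rpow_neg ha.le, ← Real.rpow_natCast a 2,
          ← Real.rpow_add ha]
        norm_num
        ring_nf

theorem trace_mul_rpow_add_le_of_le_one (hA : A.PosSemidef) (hB : B.PosSemidef) {r : ℝ}
    (hr0 : 0 ≤ r) (hr : r ≤ 1) :
    trace (A * cfc (fun x : ℝ => x ^ r) (A + B)) ≤
      trace (A * cfc (fun x : ℝ => x ^ r) B) + trace (cfc (fun x : ℝ => x ^ (r + 1)) A) := by
  have hY := hA.add hB
  rcases hr0.eq_or_lt with rfl | hr0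
  · have := trace_cfc_nonneg hA (g := fun x : ℝ => x ^ ((0 : ℝ) + 1))
      fun x hx => Real.rpow_nonneg hx _
    simp only [Real.rpow_zero, cfc_one_matrix hY.1, cfc_one_matrix hB.1]
    linarith
  rcases hr.eq_or_lt with rfl | hr
  · have e : cfc (fun x : ℝ => x ^ ((1 : ℝ) + 1)) A = A * A := by
      conv_rhs => rw [← cfc_id_matrix hA.1, ← matrix_cfc_mul]
      refine cfc_congr_eigenvalues hA.1 fun i => ?_
      rw [show (1 : ℝ) + 1 = (2 : ℕ) by norm_num, Real.rpow_natCast, sq]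
    simp only [Real.rpow_one, cfc_id_matrix hY.1, cfc_id_matrix hB.1, e, mul_add, trace_add]
    linarith
  refine le_trans ?_ (add_le_add_right (trace_sq_mul_rpow_add_le hA hB hr0 hr) _)
  rw [← sub_le_iff_le_add', ← trace_sub, ← mul_sub]
  have e : A = (A + B) - B := (add_sub_cancel_right _ _).symm
  have h1 := trace_sub_mul_cfc_sub hY.1 hB.1 (fun x : ℝ => x ^ r)
  have h2 := trace_sub_sq_mul_cfc_left hY.1 hB.1 (fun x : ℝ => x ^ (r - 1))
  rw [add_sub_cancel_right] at h1 h2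
  rw [h1, h2]
  refine Finset.sum_le_sum fun i _ => Finset.sum_le_sum fun j _ => ?_
  -- The scalar bound needs y > 0; at y = 0 either the weight vanishes or the eigenvalue of `B` is 0
  -- too.
  rcases (hY.eigenvalues_nonneg i).eq_or_lt with h0 | h0
  · rcases mul_eq_zero.1 (eigenOverlap_add_eq_zero hA hB i j h0.symm) with h | h
    · rw [h]; simp
    · rw [h, ← h0]; simp
  · exact mul_le_mul_of_nonneg_left (sub_mul_rpow_sub_le_of_le_one h0 (hB.eigenvalues_nonneg j)
      hr0 hr.le) (eigenOverlap_nonneg _ _ _ _)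

end TraceSubadditivity

/-! ### Noncommutative Khintchine inequality -/

section Khintchine

set_option linter.unusedSectionVars false

variable {m ι : Type*} [Fintype m] [DecidableEq m] [DecidableEq ι]

/-- Young's inequality by splitting at z = 2c; the coefficient 1/2 is there for later absorption. -/
theorem mul_rpow_sub_one_le {c z q : ℝ} (hc : 0 ≤ c) (hz : 0 ≤ z) (hq : 1 ≤ q) :
    c * z ^ (q - 1) ≤ 1 / 2 * z ^ q + (2 * c) ^ q := by
  have h1 := mul_rpow_sub_one hz (by linarith : q ≠ 0)
  have h2 := mul_rpow_sub_one (by positivity : 0 ≤ 2 * c) (by linarith : q ≠ 0)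
  have h3 := Real.rpow_nonneg hz (q - 1)
  have h4 : 0 ≤ (2 * c) ^ q := by positivity
  have h5 : 0 ≤ z ^ q := by positivity
  rcases le_total (2 * c) z with h | h
  · nlinarith [mul_le_mul_of_nonneg_right h h3]
  · have h6 := Real.rpow_le_rpow hz h (by linarith : 0 ≤ q - 1)
    nlinarith [mul_le_mul_of_nonneg_left h6 hc, Real.rpow_nonneg (by positivity : 0 ≤ 2 * c) (q - 1)]

theorem cfc_mul_self_arg {A : Matrix m m ℝ} (hA : A.IsHermitian) (g : ℝ → ℝ) :
    cfc g (A * A) = cfc (fun x => g (x * x)) A := by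
  have h : A * A = cfc (fun x : ℝ => x * x) A := by rw [matrix_cfc_mul, cfc_id_matrix hA]
  rw [h]
  exact (cfc_comp' g (fun x : ℝ => x * x) A
    (((Matrix.finite_real_spectrum (A := A)).image _).continuousOn _)
    (continuousOn_spectrum_matrix _ _) hA).symm

theorem abs_rpow_eq_mul_self_rpow (x p : ℝ) : |x| ^ p = (x * x) ^ (p / 2) := by
  rw [← abs_mul_abs_self x, ← sq, ← Real.rpow_natCast, ← Real.rpow_mul (abs_nonneg x)]
  congr 1
  push_cast
  ring

theorem cfc_abs_rpow {A : Matrix m m ℝ} (hA : A.IsHermitian) (p : ℝ) :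
    cfc (fun x : ℝ => |x| ^ p) A = cfc (fun x : ℝ => x ^ (p / 2)) (A * A) := by
  rw [cfc_mul_self_arg hA]
  exact cfc_congr_eigenvalues hA fun i => abs_rpow_eq_mul_self_rpow _ _

theorem posSemidef_mul_self {A : Matrix m m ℝ} (hA : A.IsHermitian) : (A * A).PosSemidef := by
  have := posSemidef_conjTranspose_mul_self A
  rwa [hA.eq] at this

/-- The value of a sign as a real number. -/
noncomputable def signValue (u : ℤˣ) : ℝ := ((u : ℤ) : ℝ)

theorem signValue_neg (u : ℤˣ) : signValue (-u) = -signValue u := by simp [signValue]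

theorem signValue_mul_self (u : ℤˣ) : signValue u * signValue u = 1 := by
  rw [signValue]
  have h := congrArg Units.val (Int.units_mul_self u)
  rw [Units.val_mul, Units.val_one] at h
  exact_mod_cast h

/-- Change of sign of one coordinate. -/
def flipSign (j : ι) : Equiv.Perm (ι → ℤˣ) :=
  Function.Involutive.toPerm (fun ε => Function.update ε j (-ε j)) fun ε => by
    ext i; by_cases h : i = j
    · subst h; simp
    · simp [h]

theorem flipSign_apply (j : ι) (ε : ι → ℤˣ) :
    flipSign j ε = Function.update ε j (-ε j) := rfl

variable [Fintype ι]

theorem sum_signValue_mul (i j : ι) :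
    ∑ ε : ι → ℤˣ, signValue (ε i) * signValue (ε j) =
      if i = j then (Fintype.card (ι → ℤˣ) : ℝ) else 0 := by
  split_ifs with h
  · subst h
    simp [signValue_mul_self]
  · have h1 := Equiv.sum_comp (flipSign i)
      (fun ε : ι → ℤˣ => signValue (ε i) * signValue (ε j))
    simp only [flipSign_apply, Function.update_self, Function.update_of_ne (Ne.symm h),
      signValue_neg, neg_mul, Finset.sum_neg_distrib] at h1
    linarith

/-- The signed sum of matrices over a set of indices. -/
noncomputable def rademacherSum (H : ι → Matrix m m ℝ) (S : Finset ι) (ε : ι → ℤˣ) :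
    Matrix m m ℝ := ∑ j ∈ S, signValue (ε j) • H j

theorem isHermitian_rademacherSum {H : ι → Matrix m m ℝ} (hH : ∀ j, (H j).IsHermitian)
    (S : Finset ι) (ε : ι → ℤˣ) : (rademacherSum H S ε).IsHermitian := by
  rw [IsHermitian, rademacherSum, conjTranspose_sum]
  simp only [conjTranspose_smul, star_trivial, (hH _).eq]

theorem rademacherSum_sub_flipSign (H : ι → Matrix m m ℝ) {S : Finset ι} {j : ι} (hj : j ∈ S)
    (ε : ι → ℤˣ) :
    rademacherSum H S ε - rademacherSum H S (flipSign j ε) = (2 * signValue (ε j)) • H j := by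
  rw [rademacherSum, rademacherSum, ← Finset.sum_sub_distrib, Finset.sum_eq_single_of_mem j hj]
  · rw [flipSign_apply, Function.update_self, signValue_neg, ← sub_smul]
    congr 1; ring
  · intro i _ hi
    rw [flipSign_apply, Function.update_of_ne hi, sub_self]

/-- A discrete integration by parts: pair each ε with its flip at `j`. The two sums differ by 2 ε_j
H_j, so the mean value trace inequality applies. -/
theorem sum_signed_trace_le {H : ι → Matrix m m ℝ} (hH : ∀ j, (H j).IsHermitian) {S : Finset ι}
    {p : ℝ} (hp : 2 ≤ p) {j : ι} (hj : j ∈ S) :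
    ∑ ε : ι → ℤˣ, signValue (ε j) *
        trace (H j * cfc (fun x : ℝ => x * |x| ^ (p - 2)) (rademacherSum H S ε)) ≤
      2 * (p - 1) * ∑ ε : ι → ℤˣ,
        trace (H j * H j * cfc (fun x : ℝ => |x| ^ (p - 2)) (rademacherSum H S ε)) := by
  set f : ℝ → ℝ := fun x => x * |x| ^ (p - 2) with hf
  set h : ℝ → ℝ := fun x => |x| ^ (p - 2) with hh
  set G : (ι → ℤˣ) → ℝ := fun ε => signValue (ε j) * trace (H j * cfc f (rademacherSum H S ε))
    with hG
  set T : (ι → ℤˣ) → ℝ := fun ε => trace (H j * H j * cfc h (rademacherSum H S ε)) with hT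
  have hpair : ∀ ε, G ε + G (flipSign j ε) ≤ 2 * (p - 1) * (T ε + T (flipSign j ε)) := by
    intro ε
    have hsub := rademacherSum_sub_flipSign H hj ε
    have key := trace_sub_mul_cfc_sub_le (isHermitian_rademacherSum hH S ε)
      (isHermitian_rademacherSum hH S (flipSign j ε)) (f := f) (h := h) (C := p - 1)
      (fun i k => sub_mul_signed_rpow_sub_le hp _ _)
    rw [hsub] at key
    have hs := signValue_mul_self (ε j)
    simp only [smul_mul_assoc, mul_smul_comm, smul_smul, trace_smul, smul_eq_mul, mul_sub,
      trace_sub] at key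
    have e : 2 * signValue (ε j) * (2 * signValue (ε j)) = 4 := by linear_combination 4 * hs
    rw [e] at key
    have e2 : signValue ((flipSign j ε) j) = -signValue (ε j) := by
      rw [flipSign_apply, Function.update_self, signValue_neg]
    simp only [hG, hT, e2]
    linarith
  have hsum := Finset.sum_le_sum fun ε (_ : ε ∈ Finset.univ) => hpair ε
  rw [Finset.sum_add_distrib, ← Finset.mul_sum, Finset.sum_add_distrib,
    Equiv.sum_comp (flipSign j) G, Equiv.sum_comp (flipSign j) T] at hsum
  linarith

theorem trace_abs_rpow_eq_sum {H : ι → Matrix m m ℝ} (hH : ∀ j, (H j).IsHermitian)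
    (S : Finset ι) {p : ℝ} (hp : 2 ≤ p) (ε : ι → ℤˣ) :
    trace (cfc (fun x : ℝ => |x| ^ p) (rademacherSum H S ε)) =
      ∑ j ∈ S, signValue (ε j) *
        trace (H j * cfc (fun x : ℝ => x * |x| ^ (p - 2)) (rademacherSum H S ε)) := by
  have hX := isHermitian_rademacherSum hH S ε
  have e : cfc (fun x : ℝ => |x| ^ p) (rademacherSum H S ε) =
      rademacherSum H S ε * cfc (fun x : ℝ => x * |x| ^ (p - 2)) (rademacherSum H S ε) := by
    conv_rhs => enter [1]; rw [← cfc_id_matrix hX]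
    rw [← matrix_cfc_mul]
    refine cfc_congr_eigenvalues hX fun i => ?_
    have h1 := mul_rpow_sub_one (abs_nonneg (hX.eigenvalues i)) (by linarith : p ≠ 0)
    have h2 := mul_rpow_sub_one (abs_nonneg (hX.eigenvalues i)) (by linarith : p - 1 ≠ 0)
    rw [show p - 1 - 1 = p - 2 by ring] at h2
    rw [← h1, ← h2, ← mul_assoc, ← mul_assoc, abs_mul_abs_self]
  rw [e]
  generalize cfc (fun x : ℝ => x * |x| ^ (p - 2)) (rademacherSum H S ε) = M
  rw [rademacherSum, Finset.sum_mul, trace_sum]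
  simp only [smul_mul_assoc, trace_smul, smul_eq_mul]

/-- The noncommutative Khintchine inequality for Hermitian matrices. -/
theorem khintchine_upper {H : ι → Matrix m m ℝ} (hH : ∀ j, (H j).IsHermitian) (S : Finset ι)
    {p : ℝ} (hp : 2 ≤ p) :
    ∑ ε : ι → ℤˣ, trace (cfc (fun x : ℝ => |x| ^ p) (rademacherSum H S ε)) ≤
      2 * ((4 * (p - 1)) ^ (p / 2) * (Fintype.card (ι → ℤˣ) *
        trace (cfc (fun x : ℝ => x ^ (p / 2)) (∑ j ∈ S, H j * H j)))) := by
  have hV : (∑ j ∈ S, H j * H j).PosSemidef :=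
    posSemidef_sum S fun j _ => posSemidef_mul_self (hH j)
  set V := ∑ j ∈ S, H j * H j with hVdef
  have h1 : ∑ ε : ι → ℤˣ, trace (cfc (fun x : ℝ => |x| ^ p) (rademacherSum H S ε)) ≤
      ∑ ε : ι → ℤˣ, 2 * (p - 1) *
        trace (V * cfc (fun x : ℝ => |x| ^ (p - 2)) (rademacherSum H S ε)) := by
    simp only [trace_abs_rpow_eq_sum hH S hp]
    rw [Finset.sum_comm]
    refine (Finset.sum_le_sum fun j hj => sum_signed_trace_le hH hp hj).trans (le_of_eq ?_)
    rw [← Finset.mul_sum, Finset.sum_comm, ← Finset.mul_sum]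
    simp only [hVdef, Finset.sum_mul, trace_sum]
  -- Young with c = 2(p-1)v and z = x²; the half of the left side it produces is absorbed, whence
  -- the factor 2.
  have h2 : ∀ ε : ι → ℤˣ, 2 * (p - 1) *
        trace (V * cfc (fun x : ℝ => |x| ^ (p - 2)) (rademacherSum H S ε)) ≤
      1 / 2 * trace (cfc (fun x : ℝ => |x| ^ p) (rademacherSum H S ε)) +
        (4 * (p - 1)) ^ (p / 2) * trace (cfc (fun x : ℝ => x ^ (p / 2)) V) := by
    intro ε
    have hX := isHermitian_rademacherSum hH S ε
    rw [trace_mul_cfc hV.1 hX, trace_cfc_right hV.1 hX, trace_cfc_left hV.1 hX]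
    simp only [Finset.mul_sum, ← Finset.sum_add_distrib]
    refine Finset.sum_le_sum fun i _ => Finset.sum_le_sum fun j _ => ?_
    have hv := hV.eigenvalues_nonneg i
    have h := mul_rpow_sub_one_le (c := 2 * (p - 1) * hV.1.eigenvalues i)
      (mul_nonneg (by linarith) hv) (mul_self_nonneg (hX.eigenvalues j)) (by linarith : 1 ≤ p / 2)
    rw [show p / 2 - 1 = (p - 2) / 2 by ring, ← abs_rpow_eq_mul_self_rpow,
      ← abs_rpow_eq_mul_self_rpow, show 2 * (2 * (p - 1) * hV.1.eigenvalues i) =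
        (4 * (p - 1)) * hV.1.eigenvalues i by ring, Real.mul_rpow (by linarith) hv] at h
    have := mul_le_mul_of_nonneg_left h (eigenOverlap_nonneg hV.1 hX i j)
    linarith
  have h3 := h1.trans (Finset.sum_le_sum fun ε _ => h2 ε)
  rw [Finset.sum_add_distrib, ← Finset.mul_sum, Finset.sum_const, nsmul_eq_mul,
    Finset.card_univ] at h3
  linarith

theorem sum_rademacherSum_mul_self (H : ι → Matrix m m ℝ) (S : Finset ι) :
    ∑ ε : ι → ℤˣ, rademacherSum H S ε * rademacherSum H S ε =
      (Fintype.card (ι → ℤˣ) : ℝ) • ∑ j ∈ S, H j * H j := by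
  simp only [rademacherSum, Finset.sum_mul, Finset.mul_sum, smul_mul_assoc, mul_smul_comm,
    Finset.smul_sum, smul_smul]
  rw [Finset.sum_comm]
  refine Finset.sum_congr rfl fun i hi => ?_
  rw [Finset.sum_comm, Finset.sum_eq_single_of_mem i hi]
  · rw [← Finset.sum_smul, sum_signValue_mul, if_pos rfl]
  · intro j _ hj
    rw [← Finset.sum_smul, sum_signValue_mul, if_neg (by tauto), zero_smul]

/-- Jensen: the square of the signed sum averages to V = ∑ H_j², so the linear term of Klein's
inequality at V cancels. -/
theorem khintchine_lower {H : ι → Matrix m m ℝ} (hH : ∀ j, (H j).IsHermitian) (S : Finset ι)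
    {p : ℝ} (hp : 2 ≤ p) :
    Fintype.card (ι → ℤˣ) * trace (cfc (fun x : ℝ => x ^ (p / 2)) (∑ j ∈ S, H j * H j)) ≤
      ∑ ε : ι → ℤˣ, trace (cfc (fun x : ℝ => |x| ^ p) (rademacherSum H S ε)) := by
  have hV : (∑ j ∈ S, H j * H j).PosSemidef :=
    posSemidef_sum S fun j _ => posSemidef_mul_self (hH j)
  have h := Finset.sum_le_sum fun ε (_ : ε ∈ (Finset.univ : Finset (ι → ℤˣ))) =>
    trace_rpow_ge_tangent (posSemidef_mul_self (isHermitian_rademacherSum hH S ε)) hV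
      (by linarith : 1 ≤ p / 2)
  rw [Finset.sum_add_distrib, ← Finset.mul_sum, ← trace_sum Finset.univ (fun ε => (rademacherSum H S ε *
    rademacherSum H S ε - _) * _), ← Finset.sum_mul, Finset.sum_sub_distrib, sum_rademacherSum_mul_self, Finset.sum_const, Finset.sum_const,
    Finset.card_univ, nsmul_eq_mul, ← Nat.cast_smul_eq_nsmul ℝ, sub_self, zero_mul,
    trace_zero, mul_zero, add_zero] at h
  refine h.trans (le_of_eq ?_)
  exact Finset.sum_congr rfl fun ε _ => by rw [cfc_abs_rpow (isHermitian_rademacherSum hH S ε)]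

end Khintchine

/-! ### Double counting of sets with a marked element -/

section Counting

variable {ι : Type*} [Fintype ι] [DecidableEq ι]

/-- The bijection (S, j) ↦ (S \ {j}, j), with inverse given by insertion. -/
theorem sum_powersetCard_succ_sum_erase (k : ℕ) (h : Finset ι → ι → ℝ) :
    ∑ S ∈ Finset.powersetCard (k + 1) (Finset.univ : Finset ι), ∑ j ∈ S, h (S.erase j) j =
      ∑ T ∈ Finset.powersetCard k (Finset.univ : Finset ι), ∑ j ∈ Tᶜ, h T j := by
  rw [Finset.sum_sigma', Finset.sum_sigma']
  refine Finset.sum_bij' (fun x _ => ⟨x.1.erase x.2, x.2⟩) (fun x _ => ⟨insert x.2 x.1, x.2⟩)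
    ?_ ?_ ?_ ?_ ?_
  · rintro ⟨S, j⟩ hx
    simp only [Finset.mem_sigma, Finset.mem_powersetCard_univ, Finset.mem_compl] at hx ⊢
    exact ⟨by rw [Finset.card_erase_of_mem hx.2, hx.1]; rfl, Finset.notMem_erase j S⟩
  · rintro ⟨T, j⟩ hx
    simp only [Finset.mem_sigma, Finset.mem_powersetCard_univ, Finset.mem_compl] at hx ⊢
    exact ⟨by rw [Finset.card_insert_of_notMem hx.2, hx.1], Finset.mem_insert_self j T⟩
  · rintro ⟨S, j⟩ hx
    simp only [Finset.mem_sigma] at hx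
    simp only [Finset.insert_erase hx.2]
  · rintro ⟨T, j⟩ hx
    simp only [Finset.mem_sigma, Finset.mem_compl] at hx
    simp only [Finset.erase_insert hx.2]
  · intros; rfl

theorem sum_powersetCard_succ_sum (k : ℕ) (w : ι → ℝ) :
    ∑ S ∈ Finset.powersetCard (k + 1) (Finset.univ : Finset ι), ∑ j ∈ S, w j =
      ((Fintype.card ι - 1).choose k : ℝ) * ∑ j, w j := by
  rw [sum_powersetCard_succ_sum_erase k (fun _ j => w j)]
  have e : ∀ T : Finset ι, ∑ j ∈ Tᶜ, w j = ∑ j, if j ∉ T then w j else 0 := fun T => by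
    rw [← Finset.sum_filter]; congr 1; ext j; simp
  simp only [e]
  rw [Finset.sum_comm, Finset.mul_sum]
  refine Finset.sum_congr rfl fun j _ => ?_
  rw [← Finset.sum_filter, Finset.sum_const, nsmul_eq_mul]
  congr 2
  have : Finset.filter (fun T => j ∉ T) (Finset.powersetCard k (Finset.univ : Finset ι)) =
      Finset.powersetCard k (Finset.univ.erase j) := by
    ext T
    simp only [Finset.mem_filter, Finset.mem_powersetCard, Finset.subset_univ, true_and,
      Finset.subset_erase]
    tauto
  rw [this, Finset.card_powersetCard, Finset.card_erase_of_mem (Finset.mem_univ j),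
    Finset.card_univ]

end Counting

/-! ### Rosenthal inequality for sampling without replacement -/

section Rosenthal

variable {m ι : Type*} [Fintype m] [DecidableEq m] [DecidableEq ι]
  {Z : ι → Matrix m m ℝ}

theorem trace_rpow_sum_mono (hZ : ∀ j, (Z j).PosSemidef) {q : ℝ} (hq : 1 ≤ q) {S T : Finset ι}
    (hST : S ⊆ T) : trace (cfc (fun x : ℝ => x ^ q) (∑ j ∈ S, Z j)) ≤
      trace (cfc (fun x : ℝ => x ^ q) (∑ j ∈ T, Z j)) := by
  rw [← Finset.sum_sdiff hST, add_comm (∑ j ∈ T \ S, Z j)]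
  exact trace_rpow_mono (posSemidef_sum _ fun j _ => hZ j) (posSemidef_sum _ fun j _ => hZ j) hq

/-- Split one factor off Y^q = (∑ Z_j) Y^(q-1) and apply the separation hypothesis to each Z_j
against the rest of the sum. -/
theorem trace_rpow_sum_le (hZ : ∀ j, (Z j).PosSemidef) {q K₁ K₂ : ℝ} (hq : 1 ≤ q)
    (hK : ∀ A B : Matrix m m ℝ, A.PosSemidef → B.PosSemidef →
      trace (A * cfc (fun x : ℝ => x ^ (q - 1)) (A + B)) ≤
        K₂ * trace (A * cfc (fun x : ℝ => x ^ (q - 1)) B) +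
          K₁ * trace (cfc (fun x : ℝ => x ^ q) A)) (S : Finset ι) :
    trace (cfc (fun x : ℝ => x ^ q) (∑ j ∈ S, Z j)) ≤
      K₂ * ∑ j ∈ S, trace (Z j * cfc (fun x : ℝ => x ^ (q - 1)) (∑ i ∈ S.erase j, Z i)) +
        K₁ * ∑ j ∈ S, trace (cfc (fun x : ℝ => x ^ q) (Z j)) := by
  have hY : (∑ j ∈ S, Z j).PosSemidef := posSemidef_sum _ fun j _ => hZ j
  have e : cfc (fun x : ℝ => x ^ q) (∑ j ∈ S, Z j) =
      (∑ j ∈ S, Z j) * cfc (fun x : ℝ => x ^ (q - 1)) (∑ j ∈ S, Z j) := by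
    conv_rhs => enter [1]; rw [← cfc_id_matrix hY.1]
    rw [← matrix_cfc_mul]
    exact cfc_congr_eigenvalues hY.1 fun i =>
      (mul_rpow_sub_one (hY.eigenvalues_nonneg i) (by linarith)).symm
  rw [e, Finset.sum_mul, trace_sum, Finset.mul_sum, Finset.mul_sum, ← Finset.sum_add_distrib]
  refine Finset.sum_le_sum fun j hj => ?_
  have := hK (Z j) (∑ i ∈ S.erase j, Z i) (hZ j) (posSemidef_sum _ fun j _ => hZ j)
  rwa [Finset.add_sum_erase S Z hj] at this

theorem trace_mul_rpow_le_young {M B : Matrix m m ℝ} (hM : M.PosSemidef) (hB : B.PosSemidef)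
    {q K l : ℝ} (hq : 1 ≤ q) (hK : 0 ≤ K) (hl : 0 < l) :
    K * trace (M * cfc (fun x : ℝ => x ^ (q - 1)) B) ≤
      l * (1 / 2 * trace (cfc (fun x : ℝ => x ^ q) B) +
        (2 * K / l) ^ q * trace (cfc (fun x : ℝ => x ^ q) M)) := by
  rw [trace_mul_cfc hM.1 hB.1, trace_cfc_right hM.1 hB.1, trace_cfc_left hM.1 hB.1]
  simp only [Finset.mul_sum, ← Finset.sum_add_distrib]
  refine Finset.sum_le_sum fun i _ => Finset.sum_le_sum fun j _ => ?_
  have hv := hM.eigenvalues_nonneg i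
  have h := mul_rpow_sub_one_le (c := K / l * hM.1.eigenvalues i)
    (by positivity) (hB.eigenvalues_nonneg j) hq
  rw [← mul_assoc, ← mul_div_assoc, Real.mul_rpow (by positivity) hv] at h
  have := mul_le_mul_of_nonneg_left h (mul_nonneg hl.le (eigenOverlap_nonneg hM.1 hB.1 i j))
  refine le_trans (le_of_eq ?_) (this.trans (le_of_eq ?_))
  · field_simp
  · ring

variable [Fintype ι]

/-- A Rosenthal type inequality for sampling positive matrices without replacement. -/
theorem rosenthal_sampling (hZ : ∀ j, (Z j).PosSemidef) {q K₁ K₂ : ℝ} (hq : 1 ≤ q)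
    (hK1 : 0 ≤ K₁) (hK2 : 1 ≤ K₂)
    (hK : ∀ A B : Matrix m m ℝ, A.PosSemidef → B.PosSemidef →
      trace (A * cfc (fun x : ℝ => x ^ (q - 1)) (A + B)) ≤
        K₂ * trace (A * cfc (fun x : ℝ => x ^ (q - 1)) B) +
          K₁ * trace (cfc (fun x : ℝ => x ^ q) A)) {k : ℕ} (hk : 1 ≤ k)
    (hkn : k ≤ Fintype.card ι) :
    ∑ S ∈ Finset.powersetCard k (Finset.univ : Finset ι),
        trace (cfc (fun x : ℝ => x ^ q) (∑ j ∈ S, Z j)) ≤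
      ((Fintype.card ι).choose k : ℝ) *
        (2 * K₁ * ((k : ℝ) / Fintype.card ι * ∑ j, trace (cfc (fun x : ℝ => x ^ q) (Z j))) +
          2 * (4 * K₂) ^ q * (((k : ℝ) / Fintype.card ι) ^ q *
            trace (cfc (fun x : ℝ => x ^ q) (∑ j, Z j)))) := by
  have hM : (∑ j, Z j).PosSemidef := posSemidef_sum _ fun j _ => hZ j
  have hpow : ∀ x : ℝ, 0 ≤ x → 0 ≤ x ^ q := fun x hx => Real.rpow_nonneg hx _
  have hpow' : ∀ x : ℝ, 0 ≤ x → 0 ≤ x ^ (q - 1) := fun x hx => Real.rpow_nonneg hx _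
  have hMq := trace_cfc_nonneg hM hpow
  have hW : 0 ≤ ∑ j, trace (cfc (fun x : ℝ => x ^ q) (Z j)) :=
    Finset.sum_nonneg fun j _ => trace_cfc_nonneg (hZ j) hpow
  obtain ⟨k, rfl⟩ : ∃ l, k = l + 1 := ⟨k - 1, by omega⟩
  set n := Fintype.card ι with hn
  set F : Finset ι → ℝ := fun S => trace (cfc (fun x : ℝ => x ^ q) (∑ j ∈ S, Z j)) with hF
  set W := ∑ j, trace (cfc (fun x : ℝ => x ^ q) (Z j)) with hWdef
  have hn0 : (0 : ℝ) < n := by exact_mod_cast (by omega : 0 < n)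
  have hC0 : (0 : ℝ) ≤ (n.choose (k + 1) : ℝ) := Nat.cast_nonneg _
  set δ : ℝ := ((k + 1 : ℕ) : ℝ) / n with hδ
  have hδ0 : 0 < δ := by positivity
  change ∑ S ∈ Finset.powersetCard (k + 1) (Finset.univ : Finset ι), F S ≤
    (n.choose (k + 1) : ℝ) * (2 * K₁ * (δ * W) + 2 * (4 * K₂) ^ q * (δ ^ q * F Finset.univ))
  change 0 ≤ F Finset.univ at hMq
  set Φ := ∑ S ∈ Finset.powersetCard (k + 1) (Finset.univ : Finset ι), F S with hΦ
  -- The sample size is now k + 1. If n < 2k then 4δ ≥ 1, and monotonicity in S alone suffices.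
  rcases lt_or_ge n (2 * k) with hlarge | hsmall
  · have h1 : Φ ≤ (n.choose (k + 1) : ℝ) * F Finset.univ := by
      have := Finset.sum_le_card_nsmul (Finset.powersetCard (k + 1) (Finset.univ : Finset ι)) F _
        fun S _ => trace_rpow_sum_mono hZ hq (Finset.subset_univ S)
      rwa [Finset.card_powersetCard, Finset.card_univ, nsmul_eq_mul] at this
    have h2 : 1 ≤ 4 * K₂ * δ := by
      have h3 : 1 ≤ 4 * δ := by
        rw [hδ, ← mul_div_assoc, one_le_div hn0]
        have : (n : ℝ) < 2 * k := by exact_mod_cast hlarge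
        push_cast; linarith
      nlinarith
    have h4 : 1 ≤ (4 * K₂) ^ q * δ ^ q := by
      rw [← Real.mul_rpow (by linarith) hδ0.le]
      exact Real.one_le_rpow h2 (by linarith)
    refine h1.trans (mul_le_mul_of_nonneg_left ?_ hC0)
    have h5 : 0 ≤ 2 * K₁ * (δ * W) := by positivity
    nlinarith [mul_le_mul_of_nonneg_right h4 hMq]
  · have hnk : (0 : ℝ) < n - k := by
      have : (k : ℝ) < n := by exact_mod_cast hkn
      linarith
    -- The ratio of C(n, k+1) to C(n, k). As Young parameter it makes the term to absorb at most
    -- half of `Φ`.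
    set l : ℝ := (n - k) / (k + 1) with hl
    have hl0 : 0 < l := by positivity
    have hchoose : (n.choose (k + 1) : ℝ) = n.choose k * l := by
      have h := Nat.choose_succ_right_eq n k
      have h' : (n.choose (k + 1) : ℝ) * (k + 1) = n.choose k * (n - k) := by
        have := congrArg (Nat.cast : ℕ → ℝ) h
        rw [Nat.cast_mul, Nat.cast_mul, Nat.cast_sub (by omega)] at this
        exact_mod_cast this
      rw [hl, ← mul_div_assoc, ← h', mul_div_cancel_right₀ _ (by positivity)]
    have hchoose' : ((n - 1).choose k : ℝ) = n.choose (k + 1) * δ := by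
      have h := Nat.add_one_mul_choose_eq (n - 1) k
      rw [show n - 1 + 1 = n by omega] at h
      have h' : (n : ℝ) * (n - 1).choose k = n.choose (k + 1) * ((k + 1 : ℕ) : ℝ) := by
        exact_mod_cast h
      rw [hδ, ← mul_div_assoc, ← h', mul_div_cancel_left₀ _ hn0.ne']
    have h1 : Φ ≤ K₂ * ∑ T ∈ Finset.powersetCard k (Finset.univ : Finset ι), ∑ j ∈ Tᶜ,
        trace (Z j * cfc (fun x : ℝ => x ^ (q - 1)) (∑ i ∈ T, Z i)) +
        K₁ * ((n.choose (k + 1) * δ) * W) := by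
      rw [← hchoose', hWdef, ← sum_powersetCard_succ_sum, ← sum_powersetCard_succ_sum_erase k
        (fun T j => trace (Z j * cfc (fun x : ℝ => x ^ (q - 1)) (∑ i ∈ T, Z i))), Finset.mul_sum,
        Finset.mul_sum, ← Finset.sum_add_distrib]
      exact Finset.sum_le_sum fun S _ => trace_rpow_sum_le hZ hq hK S
    have h2 : ∀ T ∈ Finset.powersetCard k (Finset.univ : Finset ι), K₂ * ∑ j ∈ Tᶜ,
        trace (Z j * cfc (fun x : ℝ => x ^ (q - 1)) (∑ i ∈ T, Z i)) ≤
        1 / 2 * (l * F T) + l * ((2 * K₂ / l) ^ q * F Finset.univ) := by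
      intro T _
      have hT : (∑ i ∈ T, Z i).PosSemidef := posSemidef_sum _ fun j _ => hZ j
      have h3 : ∑ j ∈ Tᶜ, trace (Z j * cfc (fun x : ℝ => x ^ (q - 1)) (∑ i ∈ T, Z i)) ≤
          trace ((∑ j, Z j) * cfc (fun x : ℝ => x ^ (q - 1)) (∑ i ∈ T, Z i)) := by
        rw [Finset.sum_mul, trace_sum]
        exact Finset.sum_le_sum_of_subset_of_nonneg (Finset.subset_univ _)
          fun j _ _ => trace_mul_nonneg_of_posSemidef (hZ j) hT hpow'
      have h4 := trace_mul_rpow_le_young hM hT hq (by linarith : 0 ≤ K₂) hl0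
      refine (mul_le_mul_of_nonneg_left h3 (by linarith)).trans (h4.trans (le_of_eq ?_))
      simp only [hF]; ring
    -- Each T has n - k one-point extensions, each S has k + 1 one-point deletions, and F is
    -- monotone.
    have h5 : l * ∑ T ∈ Finset.powersetCard k (Finset.univ : Finset ι), F T ≤ Φ := by
      have e1 := sum_powersetCard_succ_sum_erase k (fun T (_ : ι) => F T)
      have e2 : ∑ T ∈ Finset.powersetCard k (Finset.univ : Finset ι), ∑ j ∈ Tᶜ, F T =
          (n - k) * ∑ T ∈ Finset.powersetCard k (Finset.univ : Finset ι), F T := by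
        rw [Finset.mul_sum]
        refine Finset.sum_congr rfl fun T hT => ?_
        rw [Finset.sum_const, Finset.card_compl, Finset.mem_powersetCard_univ.1 hT, nsmul_eq_mul,
          Nat.cast_sub (by omega)]
      have e3 : ∑ S ∈ Finset.powersetCard (k + 1) (Finset.univ : Finset ι),
          ∑ j ∈ S, F (S.erase j) ≤ (k + 1) * Φ := by
        rw [hΦ, Finset.mul_sum]
        refine Finset.sum_le_sum fun S hS => ?_
        have := Finset.sum_le_card_nsmul S (fun j => F (S.erase j)) (F S)
          fun j _ => trace_rpow_sum_mono hZ hq (Finset.erase_subset j S)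
        rw [Finset.mem_powersetCard_univ.1 hS, nsmul_eq_mul] at this
        exact_mod_cast this
      rw [hl, div_mul_eq_mul_div, div_le_iff₀ (by positivity), ← e2, ← e1]
      linarith
    have h6 : ∑ T ∈ Finset.powersetCard k (Finset.univ : Finset ι), K₂ * ∑ j ∈ Tᶜ,
        trace (Z j * cfc (fun x : ℝ => x ^ (q - 1)) (∑ i ∈ T, Z i)) ≤
        1 / 2 * Φ + (n.choose (k + 1) : ℝ) * ((2 * K₂ / l) ^ q * F Finset.univ) := by
      refine (Finset.sum_le_sum h2).trans ?_
      rw [Finset.sum_add_distrib, ← Finset.mul_sum, ← Finset.mul_sum, Finset.sum_const,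
        Finset.card_powersetCard, Finset.card_univ, nsmul_eq_mul, ← hn, hchoose]
      linarith
    rw [← Finset.mul_sum] at h6
    have h7 : (2 * K₂ / l) ^ q ≤ (4 * K₂) ^ q * δ ^ q := by
      rw [← Real.mul_rpow (by linarith) hδ0.le]
      refine Real.rpow_le_rpow (by positivity) ?_ (by linarith)
      have hs : (2 * k : ℝ) ≤ n := by exact_mod_cast hsmall
      have : 2 / l ≤ 4 * δ := by
        rw [hl, hδ, div_div_eq_mul_div, ← mul_div_assoc, div_le_div_iff₀ hnk hn0]
        push_cast
        nlinarith [mul_nonneg (by positivity : (0:ℝ) ≤ k + 1) (sub_nonneg.2 hs)]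
      calc 2 * K₂ / l = K₂ * (2 / l) := by ring
        _ ≤ K₂ * (4 * δ) := mul_le_mul_of_nonneg_left this (by linarith)
        _ = _ := by ring
    have h8 := mul_le_mul_of_nonneg_left (mul_le_mul_of_nonneg_right h7 hMq) hC0
    linarith

end Rosenthal

/-! ### Hermitian dilation and Schatten norms -/

section Dilation

set_option linter.unusedSectionVars false

variable {m : Type*} [Fintype m] [DecidableEq m]

theorem trace_cfc_eq_roots {A : Matrix m m ℝ} (hA : A.IsHermitian) (f : ℝ → ℝ) :
    trace (cfc f A) = (A.charpoly.roots.map f).sum := by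
  rw [trace_cfc hA, hA.roots_charpoly_eq_eigenvalues, Multiset.map_map]
  rfl

/-- The Hermitian dilation of a square matrix. -/
def hermitianDilation (A : Matrix m m ℝ) : Matrix (m ⊕ m) (m ⊕ m) ℝ := fromBlocks 0 A Aᴴ 0

theorem isHermitian_hermitianDilation (A : Matrix m m ℝ) : (hermitianDilation A).IsHermitian := by
  rw [IsHermitian, hermitianDilation, fromBlocks_conjTranspose]
  simp

/-- The squared dilation is block diagonal with blocks AAᴴ and AᴴA, which share their characteristic
polynomial and so contribute equally. -/
theorem trace_abs_rpow_hermitianDilation (A : Matrix m m ℝ) (p : ℝ) :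
    trace (cfc (fun x : ℝ => |x| ^ p) (hermitianDilation A)) =
      2 * trace (cfc (fun x : ℝ => x ^ (p / 2)) (Aᴴ * A)) := by
  have hH := isHermitian_hermitianDilation A
  have h1 : hermitianDilation A * hermitianDilation A = fromBlocks (A * Aᴴ) 0 0 (Aᴴ * A) := by
    rw [hermitianDilation, fromBlocks_multiply]
    simp
  have h2 : (A * Aᴴ).charpoly = (Aᴴ * A).charpoly := charpoly_mul_comm _ _
  rw [cfc_abs_rpow hH, trace_cfc_eq_roots (posSemidef_mul_self hH).1,
    trace_cfc_eq_roots (isHermitian_conjTranspose_mul_self A), h1, charpoly_fromBlocks_zero₁₂, h2,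
    Polynomial.roots_mul (mul_ne_zero (charpoly_monic _).ne_zero (charpoly_monic _).ne_zero),
    Multiset.map_add, Multiset.sum_add, two_mul]

theorem schattenNorm_rpow {d : ℕ} (A : Matrix (Fin d) (Fin d) ℝ) {p : ℝ} (hp : p ≠ 0) :
    schattenNorm p A ^ p = 1 / 2 * trace (cfc (fun x : ℝ => |x| ^ p) (hermitianDilation A)) := by
  rw [trace_abs_rpow_hermitianDilation, schattenNorm, ← Real.rpow_mul, one_div_mul_cancel hp,
    Real.rpow_one]
  · ring
  · exact trace_cfc_nonneg (posSemidef_conjTranspose_mul_self A) fun x hx => Real.rpow_nonneg hx _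

theorem rademacherSum_hermitianDilation {n d : ℕ} (A : Fin n → Matrix (Fin d) (Fin d) ℝ)
    (S : Finset (Fin n)) (ε : Fin n → ℤˣ) :
    rademacherSum (fun j => hermitianDilation (A j)) S ε = hermitianDilation (signedSum A S ε) := by
  ext (i | i) (j | j) <;>
  simp [rademacherSum, hermitianDilation, signedSum, signValue, Matrix.sum_apply]

end Dilation

/-! ### Choice and size of the constants -/

section Constants

theorem log_mul_sqrt_le {p : ℝ} (hp : 0 < p) : √p * Real.log p ≤ 2 * p := by
  have h1 : Real.log p ≤ 2 * √p := by
    rw [← Real.sq_sqrt hp.le, Real.log_pow, Real.sqrt_sq (Real.sqrt_nonneg p)]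
    have := Real.log_le_self (Real.sqrt_nonneg p)
    push_cast
    linarith
  have h2 := mul_le_mul_of_nonneg_left h1 (Real.sqrt_nonneg p)
  have h3 := Real.mul_self_sqrt hp.le
  linarith

/-- The trace inequality `tr A (A + B) ^ (q - 1) ≤ K₂ tr A B ^ (q - 1) + K₁ tr A ^ q` with
constants of the optimal order. -/
theorem exists_trace_mul_rpow_add_le {m : Type*} [Fintype m] [DecidableEq m] {p : ℝ}
    (hp : 2 ≤ p) :
    ∃ K₁ K₂ : ℝ, 0 ≤ K₁ ∧ 1 ≤ K₂ ∧ K₁ ≤ (8 * p / Real.log p) ^ (p / 2) ∧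
      4 * K₂ ≤ 8 * p / Real.log p ∧
      ∀ A B : Matrix m m ℝ, A.PosSemidef → B.PosSemidef →
        trace (A * cfc (fun x : ℝ => x ^ (p / 2 - 1)) (A + B)) ≤
          K₂ * trace (A * cfc (fun x : ℝ => x ^ (p / 2 - 1)) B) +
            K₁ * trace (cfc (fun x : ℝ => x ^ (p / 2)) A) := by
  have hL : 0 < Real.log p := Real.log_pos (by linarith)
  have hLp : Real.log p ≤ p := Real.log_le_self (by linarith)
  rcases le_total p 4 with h4 | h4
  · have h8 : 4 ≤ 8 * p / Real.log p := by rw [le_div_iff₀ hL]; linarith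
    refine ⟨1, 1, zero_le_one, le_rfl, Real.one_le_rpow (by linarith) (by linarith), by linarith,
      fun A B hA hB => ?_⟩
    have := trace_mul_rpow_add_le_of_le_one hA hB (r := p / 2 - 1) (by linarith) (by linarith)
    rw [sub_add_cancel] at this
    linarith
  · have hr : 1 ≤ p / 2 - 1 := by linarith
    set r := p / 2 - 1 with hrdef
    -- This makes the Grönwall factor exp(3rε) equal to √p, still O(p / log p), while 1/ε = 6r / log
    -- p has the order wanted in K₁.
    set ε := Real.log p / (6 * r) with hε
    have hε0 : 0 < ε := by positivity
    have hK : Real.exp (3 * (r * ε)) = √p := by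
      rw [Real.sqrt_eq_rpow, Real.rpow_def_of_pos (by linarith)]
      congr 1
      rw [hε]; field_simp; norm_num
    have hs : 1 ≤ √p := Real.one_le_sqrt.2 (by linarith)
    have hK2 : √p ≤ 2 * p / Real.log p := by
      rw [le_div_iff₀ hL]; exact log_mul_sqrt_le (by linarith)
    have h42 : 4 * √p ≤ 8 * p / Real.log p := by
      calc 4 * √p ≤ 4 * (2 * p / Real.log p) := by linarith
        _ = _ := by ring
    have h8 : 0 ≤ 8 * p / Real.log p := by positivity
    have hK1 : ε ^ (-r) ≤ (8 * p / Real.log p) ^ r := by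
      rw [Real.rpow_neg hε0.le, ← Real.inv_rpow hε0.le]
      refine Real.rpow_le_rpow (by positivity) ?_ (by linarith)
      rw [hε, inv_div]
      exact div_le_div_of_nonneg_right (by linarith) hL.le
    refine ⟨√p * ε ^ (-r), √p, by positivity, hs, ?_, h42, fun A B hA hB => ?_⟩
    · have e : (8 * p / Real.log p) ^ (p / 2) =
          (8 * p / Real.log p) * (8 * p / Real.log p) ^ r :=
        (mul_rpow_sub_one h8 (by linarith)).symm
      rw [e]
      exact mul_le_mul (by linarith) hK1 (by positivity) h8
    · have := trace_mul_rpow_add_le hA hB hr hε0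
      rw [hK, show r + 1 = p / 2 by rw [hrdef]; ring] at this
      linarith

/-- The powers of p²/log p cancel, leaving 4 · 32^(p/2); and 16^p = 8^(p/2) · 32^(p/2) with 8^(p/2)
≥ 8. -/
theorem constant_le {p : ℝ} (hp : 2 ≤ p) :
    (p / √(Real.log p)) ^ (-p) * (4 * ((4 * p) ^ (p / 2) * (8 * p / Real.log p) ^ (p / 2))) ≤
      16 ^ p := by
  have hL : 0 < Real.log p := Real.log_pos (by linarith)
  have e1 : (p / √(Real.log p)) ^ p = (p ^ 2 / Real.log p) ^ (p / 2) := by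
    have h : p ^ 2 / Real.log p = (p / √(Real.log p)) ^ (2 : ℝ) := by
      rw [Real.rpow_two, div_pow, Real.sq_sqrt hL.le]
    rw [h, ← Real.rpow_mul (by positivity), mul_div_cancel₀ _ two_ne_zero]
  have e2 : (4 * p) ^ (p / 2) * (8 * p / Real.log p) ^ (p / 2) =
      32 ^ (p / 2) * (p ^ 2 / Real.log p) ^ (p / 2) := by
    rw [← Real.mul_rpow (by positivity) (by positivity),
      ← Real.mul_rpow (by positivity) (by positivity)]
    congr 1; ring
  have e3 : (16 : ℝ) ^ p = 8 ^ (p / 2) * 32 ^ (p / 2) := by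
    have h : (16 : ℝ) = (8 * 32) ^ (1 / 2 : ℝ) := by
      rw [show (8 * 32 : ℝ) = 16 ^ (2 : ℝ) by norm_num, ← Real.rpow_mul (by norm_num)]
      norm_num
    rw [← Real.mul_rpow (by norm_num) (by norm_num)]
    nth_rw 1 [h]
    rw [← Real.rpow_mul (by norm_num)]
    congr 1; ring
  have e4 : (4 : ℝ) ≤ 8 ^ (p / 2) := by
    calc (4 : ℝ) ≤ 8 ^ (1 : ℝ) := by norm_num
      _ ≤ 8 ^ (p / 2) := Real.rpow_le_rpow_of_exponent_le (by norm_num) (by linarith)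
  have hpos : 0 < (p ^ 2 / Real.log p) ^ (p / 2) := by positivity
  rw [Real.rpow_neg (by positivity), e1, e2, e3]
  calc _ = 4 * (32 : ℝ) ^ (p / 2) := by field_simp
    _ ≤ _ := by gcongr

end Constants

/-! ### Assembly -/

theorem theorem6p1 :
    ∃ c : ℝ, 0 < c ∧
      ∀ p : ℝ, 2 ≤ p →
      ∀ (d n k : ℕ), 1 ≤ k → k ≤ n →
      ∀ A : Fin n → Matrix (Fin d) (Fin d) ℝ,
        (p / √(Real.log p)) ^ (-p) / ((2 : ℝ) ^ n * (n.choose k : ℝ)) *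
            ∑ S ∈ Finset.powersetCard k (Finset.univ : Finset (Fin n)),
              ∑ ε : Fin n → ℤˣ, schattenNorm p (signedSum A S ε) ^ p
          ≤ c ^ p *
            ((k : ℝ) / (n : ℝ) * ∑ j : Fin n, schattenNorm p (A j) ^ p
              + ((k : ℝ) / (n : ℝ)) ^ (p / 2) / (2 : ℝ) ^ n *
                ∑ ε : Fin n → ℤˣ, schattenNorm p (signedSum A Finset.univ ε) ^ p) := by
  refine ⟨16, by norm_num, fun p hp d n k hk hkn A => ?_⟩
  have hp0 : p ≠ 0 := by linarith
  have hL : 0 < Real.log p := Real.log_pos (by linarith)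
  set H : Fin n → Matrix (Fin d ⊕ Fin d) (Fin d ⊕ Fin d) ℝ := fun j => hermitianDilation (A j)
    with hHdef
  have hH : ∀ j, (H j).IsHermitian := fun j => isHermitian_hermitianDilation _
  have hnorm : ∀ S ε, schattenNorm p (signedSum A S ε) ^ p =
      1 / 2 * trace (cfc (fun x : ℝ => |x| ^ p) (rademacherSum H S ε)) := fun S ε => by
    rw [rademacherSum_hermitianDilation, schattenNorm_rpow _ hp0]
  have hnorm1 : ∀ j, schattenNorm p (A j) ^ p =
      1 / 2 * trace (cfc (fun x : ℝ => x ^ (p / 2)) (H j * H j)) := fun j => by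
    rw [schattenNorm_rpow _ hp0, cfc_abs_rpow (hH j)]
  have hcard : (Fintype.card (Fin n → ℤˣ) : ℝ) = 2 ^ n := by
    rw [Fintype.card_fun, Fintype.card_units_int, Fintype.card_fin]; norm_num
  obtain ⟨K₁, K₂, hK1, hK2, hK1', hK2', hK⟩ :=
    exists_trace_mul_rpow_add_le (m := Fin d ⊕ Fin d) hp
  have hros := rosenthal_sampling (fun j => posSemidef_mul_self (hH j)) (by linarith : 1 ≤ p / 2)
    hK1 hK2 hK hk (by rwa [Fintype.card_fin])
  rw [Fintype.card_fin] at hros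
  have hlow := khintchine_lower hH Finset.univ hp
  have hup := fun S => khintchine_upper hH S hp
  rw [hcard] at hlow
  simp only [hcard] at hup
  simp only [hnorm, hnorm1, ← Finset.mul_sum]
  set R := (8 * p / Real.log p) ^ (p / 2) with hR
  set W := ∑ j, trace (cfc (fun x : ℝ => x ^ (p / 2)) (H j * H j)) with hW
  set Q := trace (cfc (fun x : ℝ => x ^ (p / 2)) (∑ j, H j * H j)) with hQ
  set E := ∑ ε : Fin n → ℤˣ, trace (cfc (fun x : ℝ => |x| ^ p) (rademacherSum H Finset.univ ε))
    with hE
  set Φ := ∑ S ∈ Finset.powersetCard k (Finset.univ : Finset (Fin n)),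
    trace (cfc (fun x : ℝ => x ^ (p / 2)) (∑ j ∈ S, H j * H j)) with hΦ
  set δ := (k : ℝ) / n with hδ
  have hδ0 : 0 ≤ δ := by positivity
  have hδq : 0 ≤ δ ^ (p / 2) := Real.rpow_nonneg hδ0 _
  have h2n : (0 : ℝ) < 2 ^ n := by positivity
  have hC : (0 : ℝ) < n.choose k := by exact_mod_cast Nat.choose_pos hkn
  have hW0 : 0 ≤ W := Finset.sum_nonneg fun j _ => trace_cfc_nonneg (posSemidef_mul_self (hH j))
    fun x hx => Real.rpow_nonneg hx _
  have hQ0 : 0 ≤ Q := trace_cfc_nonneg (posSemidef_sum _ fun j _ => posSemidef_mul_self (hH j))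
    fun x hx => Real.rpow_nonneg hx _
  have hR0 : 0 ≤ R := by positivity
  have hQE : Q ≤ E / 2 ^ n := by rw [le_div_iff₀ h2n]; linarith
  have hK2q : (4 * K₂) ^ (p / 2) ≤ R :=
    Real.rpow_le_rpow (by linarith) hK2' (by linarith)
  have h1 : Φ ≤ (n.choose k : ℝ) * (2 * R * (δ * W + δ ^ (p / 2) * (E / 2 ^ n))) := by
    refine hros.trans (mul_le_mul_of_nonneg_left ?_ hC.le)
    have a1 : 2 * K₁ * (δ * W) ≤ 2 * R * (δ * W) := by gcongr
    have a2 : 2 * (4 * K₂) ^ (p / 2) * (δ ^ (p / 2) * Q) ≤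
        2 * R * (δ ^ (p / 2) * (E / 2 ^ n)) := by gcongr
    linarith
  have hpp : (4 * (p - 1)) ^ (p / 2) ≤ (4 * p) ^ (p / 2) :=
    Real.rpow_le_rpow (by linarith) (by linarith) (by linarith)
  have hB0 : 0 ≤ δ * W + δ ^ (p / 2) * (E / 2 ^ n) :=
    add_nonneg (mul_nonneg hδ0 hW0) (mul_nonneg hδq (hQ0.trans hQE))
  have h2 : ∑ S ∈ Finset.powersetCard k (Finset.univ : Finset (Fin n)), ∑ ε : Fin n → ℤˣ,
      trace (cfc (fun x : ℝ => |x| ^ p) (rademacherSum H S ε)) ≤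
      2 * ((4 * p) ^ (p / 2) * (2 ^ n *
        ((n.choose k : ℝ) * (2 * R * (δ * W + δ ^ (p / 2) * (E / 2 ^ n)))))) := by
    refine (Finset.sum_le_sum fun S _ => hup S).trans ?_
    simp only [← Finset.mul_sum]
    have hΦ0 : 0 ≤ 2 ^ n * Φ := mul_nonneg h2n.le <| Finset.sum_nonneg fun S _ =>
      trace_cfc_nonneg (posSemidef_sum _ fun j _ => posSemidef_mul_self (hH j))
        fun x hx => Real.rpow_nonneg hx _
    exact mul_le_mul_of_nonneg_left (mul_le_mul hpp (mul_le_mul_of_nonneg_left h1 h2n.le) hΦ0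
      (by positivity)) zero_le_two
  have hD : 0 ≤ (p / √(Real.log p)) ^ (-p) := by positivity
  calc _ ≤ (p / √(Real.log p)) ^ (-p) / ((2 : ℝ) ^ n * (n.choose k : ℝ)) *
        (1 / 2 * (2 * ((4 * p) ^ (p / 2) * (2 ^ n *
          ((n.choose k : ℝ) * (2 * R * (δ * W + δ ^ (p / 2) * (E / 2 ^ n)))))))) := by gcongr
    -- The 4 collects a 2 from Khintchine and a 2 from Rosenthal; the 1/2 is the dilation's factor,
    -- common to both sides.
    _ = (p / √(Real.log p)) ^ (-p) * (4 * ((4 * p) ^ (p / 2) * R)) *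
        (1 / 2 * (δ * W + δ ^ (p / 2) * (E / 2 ^ n))) := by field_simp; ring
    _ ≤ 16 ^ p * (1 / 2 * (δ * W + δ ^ (p / 2) * (E / 2 ^ n))) :=
      mul_le_mul_of_nonneg_right (constant_le hp) (by positivity)
    _ = _ := by ring
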